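/- Let $H:\mathbb{R}^2\to\mathbb{R}$ satisfy: (1) $H\in C^4$ with bounded second derivative; (2) $H$ has finitely many critical points, all non-degenerate, with pairwise distinct critical values; (3) there are $a_1,a_2,a_3>0$ with $H(x)\ge a_1|x|^2$, $|\nabla H(x)|\ge a_2|x|$ and $\Delta H(x)\ge a_3$ for all $x$ with $|x|$ large enough; (4) $\min H=0$. Let $\Gamma$ be the graph obtained from $\mathbb{R}^2$ by identifying all points lying in the same connected component of a level set of $H$ (with the quotient topology), and $\Pi:\mathbb{R}^2\to\Gamma$ the identification map. The vertices of $\Gamma$ are the images of the critical points, and its open edges $I_k$ are the connected components of the complement of the vertices. A point of $I_k$ is written $(z,k)$, where $z$ is the value of $H$ on the corresponding level set component $C_k(z)=\Pi^{-1}(z,k)$, and $T_k(z)=\oint_{C_k(z)}|\nabla H|^{-1}\,dl$, where $dl$ is the length element. For $\epsilon>0$ and $x\in\mathbb{R}^2$ let $X_\epsilon^x$ be the solution of $$dX_\epsilon(t)=\tfrac1\epsilon\bar\nabla H(X_\epsilon(t))\,dt+dw(t),\qquad X_\epsilon(0)=x,$$ where $\bar\nabla H=(-\partial_2H,\partial_1H)$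 and $w$ is a two-dimensional standard Brownian motion, and let $S_\epsilon(t)u(x)=\mathbb{E}\,u(X_\epsilon^x(t))$. Then for every $\lambda>0$ there are a positive non-increasing function $h\in C^2([0,\infty))$ that equals $Ce^{-\lambda\sqrt z}$ for all sufficiently large $z$, for some constant $C>0$, and a strictly positive continuous function $\gamma:\Gamma\to(0,\infty)$ with $\gamma\circ\Pi=h\circ H$, such that $$\sum_k\int_{I_k}\gamma(z,k)\,T_k(z)\,dz<\infty ,$$ and such that the following holds with $H_\gamma=L^2(\mathbb{R}^2,\gamma(\Pi(x))\,dx)$. There is a constant $c>0$ such that, for every $\epsilon>0$, $S_\epsilon(t)$, $t\ge0$, is well defined on $H_\gamma$ (for each $u\in H_\gamma$ the expectation $\mathbb{E}\,u(X_\epsilon^x(t))$ exists for almost every $x$ and defines an element of $H_\gamma$ that does not depend on the representative of $u$), is a semigroup of bounded linear operators there, and satisfies $$\|S_\epsilon(t)\|_{\mathcal{L}(H_\gamma)}\le e^{ct},\qquad t\ge0 .$$ In particular, for every $T>0$, $\|S_\epsilon(t)\|_{\mathcal L(H_\gamma)}\le c_T:=e^{cT}$ for all $t\in[0,T]$ and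 $\epsilon>0$. -/

import Mathlib

open MeasureTheory ProbabilityTheory Set
open scoped NNReal ENNReal

/-- The Euclidean plane `ℝ²`. -/
abbrev Plane : Type := EuclideanSpace ℝ (Fin 2)

noncomputable section

/-- The skew gradient `∇̄H = (-∂₂H, ∂₁H)`. -/
def skewGradient (H : Plane → ℝ) (x : Plane) : Plane :=
  !₂[-(gradient H x 1), gradient H x 0]

/-- The Hessian matrix of `H` at `x`, in the standard coordinates. -/
def hessian (H : Plane → ℝ) (x : Plane) : Matrix (Fin 2) (Fin 2) ℝ :=
  Matrix.of fun i j =>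
    iteratedFDeriv ℝ 2 H x ![EuclideanSpace.single i (1 : ℝ), EuclideanSpace.single j (1 : ℝ)]

/-- The set of critical points of `H`. -/
def criticalSet (H : Plane → ℝ) : Set Plane := {x | gradient H x = 0}

/-- The standing assumptions on the Hamiltonian: `C⁴` with bounded second derivative, finitely many
critical points, all non-degenerate and at pairwise distinct levels, quadratic growth at infinity,
and minimum equal to zero. -/
structure IsGenericHamiltonian (H : Plane → ℝ) : Prop where
  contDiff : ContDiff ℝ 4 H
  bounded_second : ∃ C : ℝ, ∀ x, ‖iteratedFDeriv ℝ 2 H x‖ ≤ C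
  finite_critical : (criticalSet H).Finite
  nondegenerate : ∀ x ∈ criticalSet H, (hessian H x).det ≠ 0
  distinct_values : InjOn H (criticalSet H)
  growth : ∃ a₁ > (0 : ℝ), ∃ a₂ > (0 : ℝ), ∃ a₃ > (0 : ℝ), ∃ R : ℝ, ∀ x : Plane, R ≤ ‖x‖ →
    a₁ * ‖x‖ ^ 2 ≤ H x ∧ a₂ * ‖x‖ ≤ ‖gradient H x‖ ∧ a₃ ≤ Laplacian.laplacian H x
  min_eq_zero : IsLeast (range H) 0

/-! ### The graph of the connected components of the level sets -/

/-- The connected component, containing `x`, of the level set `{y | H y = H x}`. -/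
def levelComponent (H : Plane → ℝ) (x : Plane) : Set Plane :=
  connectedComponentIn {y | H y = H x} x

/-- The graph `Γ`: the plane with all points of each connected component of each level set of `H`
identified. It carries the quotient topology. -/
abbrev LevelGraph (H : Plane → ℝ) : Type := Quotient (Setoid.ker (levelComponent H))

namespace LevelGraph

variable {H : Plane → ℝ}

/-- The identification map `Π : ℝ² → Γ`. -/
def proj (H : Plane → ℝ) (x : Plane) : LevelGraph H := Quotient.mk _ x

/-- A point lies on its own level component. -/
theorem mem_levelComponent (H : Plane → ℝ) (x : Plane) : x ∈ levelComponent H x :=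
  mem_connectedComponentIn rfl

/-- The coordinate `z` of a point of the graph: the value of `H` on the corresponding component. -/
def height (H : Plane → ℝ) : LevelGraph H → ℝ :=
  Quotient.lift H fun x y hxy => by
    have h : x ∈ levelComponent H y := by
      have e : levelComponent H x = levelComponent H y := hxy
      exact e ▸ mem_levelComponent H x
    exact connectedComponentIn_subset {a | H a = H y} y h

/-- The (finite) vertices of the graph: the images of the critical points. -/
def vertices (H : Plane → ℝ) : Set (LevelGraph H) := proj H '' criticalSet H

/-- The open edges of the graph: the connected components of the complement of the vertices. -/
def edges (H : Plane → ℝ) : Set (Set (LevelGraph H)) :=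
  {I | ∃ p ∈ (vertices H)ᶜ, I = connectedComponentIn (vertices H)ᶜ p}

/-- The point `(z, k)`, that is, the point at height `z` of the edge `I = I_k`
(used only for `z ∈ height H '' I`). -/
def edgePoint (I : Set (LevelGraph H)) (z : ℝ) : LevelGraph H :=
  haveI : Nonempty (LevelGraph H) := ⟨proj H 0⟩
  Function.invFunOn (height H) I z

/-- The period `T = ∮ |∇H|⁻¹ dl` over the level component that corresponds to a point of the graph;
the length element is the one-dimensional Hausdorff measure. -/
def period (p : LevelGraph H) : ℝ≥0∞ :=
  ∫⁻ x in proj H ⁻¹' {p}, ENNReal.ofReal ‖gradient H x‖⁻¹ ∂(Measure.hausdorffMeasure 1)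

/-- The quantity `∑ₖ ∫_{I_k} γ(z, k) T_k(z) dz`. -/
def totalMass (γ : LevelGraph H → ℝ) : ℝ≥0∞ :=
  ∑' I : edges H, ∫⁻ z in height H '' I.1,
    ENNReal.ofReal (γ (edgePoint I.1 z)) * period (edgePoint I.1 z)

/-- The weighted measure `γ(Π(x)) dx` on the plane, so that `Lp ℝ 2 (weightedMeasure γ)` is the
space `H_γ`. -/
def weightedMeasure (γ : LevelGraph H → ℝ) : Measure Plane :=
  volume.withDensity fun x => ENNReal.ofReal (γ (proj H x))

end LevelGraph

/-! ### The stochastic equation and its transition semigroup -/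

variable {Ω : Type*} [MeasurableSpace Ω]

/-- A two-dimensional standard Brownian motion: its coordinates are independent real standard
Brownian motions. -/
structure IsPlanarBrownian (w : ℝ≥0 → Ω → Plane) (P : Measure Ω) : Prop where
  coord : ∀ i, IsBrownianReal (fun t ω => w t ω i) P
  indep : iIndepFun (fun (i : Fin 2) ω (t : ℝ≥0) => w t ω i) P

/-- `X` is a (strong) solution of `dX = ε⁻¹ ∇̄H(X) dt + dw`, `X(0) = x`: its paths are
almost surely continuous and satisfy the integrated equation. -/
def SolvesSDE (H : Plane → ℝ) (ε : ℝ) (w : ℝ≥0 → Ω → Plane) (P : Measure Ω) (x : Plane)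
    (X : ℝ≥0 → Ω → Plane) : Prop :=
  ∀ᵐ ω ∂P, Continuous (fun t => X t ω) ∧
    ∀ t : ℝ≥0, X t ω =
      x + ε⁻¹ • (∫ s in (0 : ℝ)..t, skewGradient H (X s.toNNReal ω)) + w t ω

/-- The transition operator `u ↦ (x ↦ 𝔼 u(Xˣ(t)))` of a family of processes `X x`, `x ∈ ℝ²`. -/
def transition (P : Measure Ω) (X : Plane → ℝ≥0 → Ω → Plane) (t : ℝ≥0) (u : Plane → ℝ)
    (x : Plane) : ℝ :=
  ∫ ω, u (X x t ω) ∂P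

/-- The transition operators of the family `X` are well defined on `L²(μ)` and are given there by
the semigroup `S` of bounded operators: for every square integrable `u` the expectation
`𝔼 u(Xˣ(t))` exists for almost every `x`, and it is a representative of `S t u`, whichever
representative of `u` is used. -/
structure IsTransitionSemigroupOn (μ : Measure Plane) (P : Measure Ω)
    (X : Plane → ℝ≥0 → Ω → Plane) (S : ℝ≥0 → Lp ℝ 2 μ →L[ℝ] Lp ℝ 2 μ) : Prop where
  integrable : ∀ (t : ℝ≥0) (u : Plane → ℝ), MemLp u 2 μ →
    ∀ᵐ x ∂μ, Integrable (fun ω => u (X x t ω)) P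
  apply_eq : ∀ (t : ℝ≥0) (u : Plane → ℝ) (hu : MemLp u 2 μ),
    S t (hu.toLp u) =ᵐ[μ] transition P X t u
  zero : S 0 = ContinuousLinearMap.id ℝ (Lp ℝ 2 μ)
  add : ∀ s t : ℝ≥0, S (s + t) = (S s).comp (S t)

end

/-! The weight is `profile lam ∘ H`, where `profile lam` is exp(-λ s) and s = `smoothSqrt` is a
smooth function equal to √z for z ≥ 2. Everything reduces to one domination: if the starting point
is distributed according to γ dx, the law of the solution at time t is at most e^{ct} γ dx. Jensen's
inequality then bounds the averaging operator on L²(γ dx) by e^{ct/2} (`exists_average_operator`).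

The domination holds because the two parts of the dynamics act separately. The field ∇̄H is
divergence free and tangent to the level sets of H, so its flow preserves γ dx whatever ε is.
Brownian motion inflates γ dx at a bounded rate: a non-negative H with bounded Hessian satisfies
|∇H|² ≤ 4MH, hence s∘H has bounded first and second derivatives, and γ obeys a Taylor bound with
relative error O(|y|² e^{K|y|}) (`exists_profile_taylor`). Under a centred Gaussian the linear term
vanishes (`exists_lintegral_weight_gaussPlane_le`).

The argument uses an explicit scheme alternating a drift step and a Gaussian step instead of Itô
calculus. A drift step of length r preserves γ dx only up to exp(κ R r²), where R is the level of H
at which the field is cut off (`exists_lintegral_weight_drift_le`). With n+1 steps and R = √(n+1)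
the accumulated drift error is O((n+1)^{-1/2}) and disappears in the limit, which is why c does not
depend on ε. Since the noise is additive, the scheme converges along almost every path
(`tendsto_scheme`), and Fatou's lemma carries the domination over (`map_le_of_tendsto`). The
semigroup law passes to the limit from the Markov property of the scheme, first for compactly
supported continuous functions and then by density.

By the coarea formula the mass of the graph should be ∫ γ dx, which is finite by the quadratic
growth of H. Only an upper bound up to a constant is needed; it follows from Eilenberg's inequality
on pieces of the plane where |∇H| is nearly constant (`exists_measurable_level_integral_le`). -/

noncomputable section

variable {Ω : Type*} [MeasurableSpace Ω]

open Filter Topology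

/-! ### Geometry of the Hamiltonian vector field -/

section Hamiltonian

/-- The standard basis vectors of the plane. -/
def planeBasis (i : Fin 2) : Plane := EuclideanSpace.single i (1 : ℝ)

theorem norm_sq_plane (v : Plane) : ‖v‖ ^ 2 = v 0 ^ 2 + v 1 ^ 2 := by
  rw [EuclideanSpace.norm_sq_eq, Fin.sum_univ_two]; simp

theorem norm_planeBasis (i : Fin 2) : ‖planeBasis i‖ = 1 := by simp [planeBasis]

theorem abs_coord_le (v : Plane) (i : Fin 2) : |v i| ≤ ‖v‖ := by
  simpa using PiLp.norm_apply_le v i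

/-- The rotation by a right angle, precomposed with the Riesz identification of the dual. -/
def rotDual : (Plane →L[ℝ] ℝ) →L[ℝ] Plane :=
  (ContinuousLinearMap.apply ℝ ℝ (planeBasis 0)).smulRight (planeBasis 1) -
    (ContinuousLinearMap.apply ℝ ℝ (planeBasis 1)).smulRight (planeBasis 0)

theorem rotDual_apply (l : Plane →L[ℝ] ℝ) :
    rotDual l = l (planeBasis 0) • planeBasis 1 - l (planeBasis 1) • planeBasis 0 := by
  simp [rotDual]

theorem rotDual_apply_zero (l : Plane →L[ℝ] ℝ) : rotDual l 0 = -l (planeBasis 1) := by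
  rw [rotDual_apply]; simp [planeBasis]

theorem rotDual_apply_one (l : Plane →L[ℝ] ℝ) : rotDual l 1 = l (planeBasis 0) := by
  rw [rotDual_apply]; simp [planeBasis]

theorem apply_rotDual (l : Plane →L[ℝ] ℝ) : l (rotDual l) = 0 := by
  rw [rotDual_apply]; simp [mul_comm]

/-- Testing l on its own gradient v gives ‖v‖² = l v ≤ ‖l‖ ‖v‖, and rotation does not change the
length of v. -/
theorem norm_rotDual_le (l : Plane →L[ℝ] ℝ) : ‖rotDual l‖ ≤ ‖l‖ := by
  set v : Plane := l (planeBasis 0) • planeBasis 0 + l (planeBasis 1) • planeBasis 1 with hv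
  have h0 : v 0 = l (planeBasis 0) := by simp [hv, planeBasis]
  have h1 : v 1 = l (planeBasis 1) := by simp [hv, planeBasis]
  have hn : ‖v‖ ^ 2 = ‖rotDual l‖ ^ 2 := by
    rw [norm_sq_plane, norm_sq_plane, rotDual_apply_zero, rotDual_apply_one, h0, h1]; ring
  have hn' : ‖v‖ = ‖rotDual l‖ := by
    rwa [sq_eq_sq₀ (norm_nonneg _) (norm_nonneg _)] at hn
  have hl : l v = ‖v‖ ^ 2 := by
    rw [norm_sq_plane, h0, h1, hv]; simp; ring
  have := l.le_opNorm v
  rw [hl, Real.norm_of_nonneg (by positivity)] at this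
  rw [← hn']
  by_contra! hlt
  nlinarith [norm_nonneg l]

theorem skewGradient_eq_rotDual (H : Plane → ℝ) (x : Plane) :
    skewGradient H x = rotDual (fderiv ℝ H x) := by
  have key : ∀ i, gradient H x i = fderiv ℝ H x (planeBasis i) := by
    intro i
    rw [← inner_gradient_left, planeBasis, EuclideanSpace.inner_single_right]; simp
  ext i
  fin_cases i
  · simp [skewGradient, rotDual_apply_zero, key]
  · simp [skewGradient, rotDual_apply_one, key]

theorem norm_gradient (H : Plane → ℝ) (x : Plane) : ‖gradient H x‖ = ‖fderiv ℝ H x‖ := by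
  simp [gradient]

/-- The analytic part of the assumptions on the Hamiltonian: twice continuously differentiable,
non-negative, with Hessian bounded by `M`. -/
structure IsTameHamiltonian (H : Plane → ℝ) (M : ℝ) : Prop where
  contDiff : ContDiff ℝ 2 H
  pos : 0 < M
  nonneg : ∀ x, 0 ≤ H x
  bound : ∀ x, ‖fderiv ℝ (fderiv ℝ H) x‖ ≤ M

variable {H : Plane → ℝ} {M : ℝ}

theorem IsGenericHamiltonian.exists_isTame (hH : IsGenericHamiltonian H) :
    ∃ M, IsTameHamiltonian H M := by
  obtain ⟨C, hC⟩ := hH.bounded_second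
  refine ⟨max C 1, hH.contDiff.of_le (by norm_num), by positivity,
    fun x => hH.min_eq_zero.2 ⟨x, rfl⟩, fun x => ?_⟩
  rw [← norm_iteratedFDeriv_one, norm_iteratedFDeriv_fderiv]
  exact (hC x).trans (le_max_left _ _)

namespace IsTameHamiltonian

theorem differentiable (h : IsTameHamiltonian H M) : Differentiable ℝ H :=
  h.contDiff.differentiable (by norm_num)

theorem continuous (h : IsTameHamiltonian H M) : Continuous H := h.differentiable.continuous

theorem contDiff_fderiv (h : IsTameHamiltonian H M) : ContDiff ℝ 1 (fderiv ℝ H) :=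
  h.contDiff.fderiv_right (by norm_num)

theorem differentiable_fderiv (h : IsTameHamiltonian H M) : Differentiable ℝ (fderiv ℝ H) :=
  h.contDiff_fderiv.differentiable (by norm_num)

theorem norm_fderiv_sub_le (h : IsTameHamiltonian H M) (x y : Plane) :
    ‖fderiv ℝ H x - fderiv ℝ H y‖ ≤ M * ‖x - y‖ :=
  convex_univ.norm_image_sub_le_of_norm_fderiv_le (fun z _ => h.differentiable_fderiv z)
    (fun z _ => h.bound z) (mem_univ y) (mem_univ x)

theorem abs_taylor_le (h : IsTameHamiltonian H M) (x v : Plane) :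
    |H (x + v) - H x - fderiv ℝ H x v| ≤ M * ‖v‖ ^ 2 := by
  have := (convex_segment (𝕜 := ℝ) x (x + v)).norm_image_sub_le_of_norm_fderiv_le'
    (f := H) (φ := fderiv ℝ H x) (C := M * ‖v‖) (fun z _ => h.differentiable z)
    (fun z hz => by
      refine (h.norm_fderiv_sub_le z x).trans ?_
      have := norm_sub_le_of_mem_segment hz
      simp only [add_sub_cancel_left] at this
      exact mul_le_mul_of_nonneg_left this h.pos.le)
    (left_mem_segment ℝ x (x + v)) (right_mem_segment ℝ x (x + v))
  simp only [add_sub_cancel_left, Real.norm_eq_abs] at this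
  calc _ ≤ _ := this
    _ = _ := by ring

/-- Non-negativity forces this: a large gradient at a small value of H would push H below zero
within a short distance. All later uniformity in x rests on it. -/
theorem norm_fderiv_sq_le (h : IsTameHamiltonian H M) (x : Plane) :
    ‖fderiv ℝ H x‖ ^ 2 ≤ 4 * M * H x := by
  have hM := h.pos
  set l := fderiv ℝ H x with hl
  set v : Plane := (InnerProductSpace.toDual ℝ Plane).symm l with hv
  have hlv : l v = ‖l‖ ^ 2 := by
    rw [← InnerProductSpace.toDual_symm_apply (x := v) (y := l), ← hv,
      real_inner_self_eq_norm_sq, hv, LinearIsometryEquiv.norm_map]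
  have hnv : ‖v‖ = ‖l‖ := by rw [hv, LinearIsometryEquiv.norm_map]
  -- The step length 1/(2M) minimises the Taylor upper bound H - s‖l‖² + M s²‖l‖² over s.
  have h1 := h.abs_taylor_le x (-(1 / (2 * M)) • v)
  have h2 := h.nonneg (x + -(1 / (2 * M)) • v)
  rw [map_smul, ← hl, hlv, norm_smul, hnv, norm_neg, Real.norm_of_nonneg (by positivity)] at h1
  have h3 := (abs_le.1 h1).2
  simp only [smul_eq_mul] at h3
  have h4 : M * (1 / (2 * M) * ‖l‖) ^ 2 = ‖l‖ ^ 2 / (4 * M) := by field_simp; ring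
  have h5 : 1 / (2 * M) * ‖l‖ ^ 2 = 2 * (‖l‖ ^ 2 / (4 * M)) := by field_simp; ring
  have h6 : ‖l‖ ^ 2 / (4 * M) ≤ H x := by linarith
  rw [div_le_iff₀ (by positivity)] at h6
  linarith

end IsTameHamiltonian

end Hamiltonian

/-! ### The truncated drift -/

section Truncation

/-- A smooth cutoff, equal to one on `(-∞, 1]` and to zero on `[2, ∞)`. -/
def cutoff (z : ℝ) : ℝ := Real.smoothTransition (2 - z)

theorem cutoff_contDiff {n : ℕ∞} : ContDiff ℝ n cutoff :=
  Real.smoothTransition.contDiff.comp (by fun_prop)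

theorem cutoff_nonneg (z : ℝ) : 0 ≤ cutoff z := Real.smoothTransition.nonneg _

theorem cutoff_le_one (z : ℝ) : cutoff z ≤ 1 := Real.smoothTransition.le_one _

theorem cutoff_eq_one {z : ℝ} (hz : z ≤ 1) : cutoff z = 1 :=
  Real.smoothTransition.one_of_one_le (by linarith)

theorem cutoff_eq_zero {z : ℝ} (hz : 2 ≤ z) : cutoff z = 0 :=
  Real.smoothTransition.zero_of_nonpos (by linarith)

theorem deriv_cutoff_eq_zero {z : ℝ} (hz : 2 < z) : deriv cutoff z = 0 := by
  have : cutoff =ᶠ[𝓝 z] fun _ => (0 : ℝ) := by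
    filter_upwards [lt_mem_nhds hz] with y hy using cutoff_eq_zero hy.le
  rw [this.deriv_eq, deriv_const]

theorem deriv_cutoff_eq_zero' {z : ℝ} (hz : z < 1) : deriv cutoff z = 0 := by
  have : cutoff =ᶠ[𝓝 z] fun _ => (1 : ℝ) := by
    filter_upwards [gt_mem_nhds hz] with y hy using cutoff_eq_one hy.le
  rw [this.deriv_eq, deriv_const]

theorem exists_deriv_cutoff_le : ∃ C > (0 : ℝ), ∀ z, |deriv cutoff z| ≤ C := by
  have hc : Continuous (deriv cutoff) :=
    (cutoff_contDiff (n := 1)).continuous_deriv le_rfl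
  obtain ⟨C, hC⟩ := (isCompact_Icc (a := (1 : ℝ)) (b := 2)).exists_bound_of_continuousOn
    hc.continuousOn
  refine ⟨max C 1, by positivity, fun z => ?_⟩
  by_cases h1 : z < 1
  · rw [deriv_cutoff_eq_zero' h1, abs_zero]; positivity
  by_cases h2 : 2 < z
  · rw [deriv_cutoff_eq_zero h2, abs_zero]; positivity
  exact (hC z ⟨not_lt.1 h1, not_lt.1 h2⟩).trans (le_max_left _ _)

/-- The skew gradient of `H`, cut off outside of the sublevel set `{H ≤ 2 R}` by a function of
`H`. -/
def truncField (H : Plane → ℝ) (R : ℝ) (x : Plane) : Plane :=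
  cutoff (H x / R) • rotDual (fderiv ℝ H x)

/-- The derivative of the truncated drift. -/
def truncFieldDeriv (H : Plane → ℝ) (R : ℝ) (x : Plane) : Plane →L[ℝ] Plane :=
  cutoff (H x / R) • (rotDual ∘L fderiv ℝ (fderiv ℝ H) x) +
    ((deriv cutoff (H x / R) / R) • fderiv ℝ H x).smulRight (rotDual (fderiv ℝ H x))

variable {H : Plane → ℝ} {M R : ℝ}

theorem truncField_eq_skewGradient (hR : 0 < R) {x : Plane} (hx : H x ≤ R) :
    truncField H R x = skewGradient H x := by
  rw [truncField, cutoff_eq_one (by rwa [div_le_one hR]), one_smul, skewGradient_eq_rotDual]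

theorem fderiv_apply_truncField (x : Plane) : fderiv ℝ H x (truncField H R x) = 0 := by
  rw [truncField, map_smul, apply_rotDual, smul_zero]

namespace IsTameHamiltonian

theorem hasFDerivAt_truncField (h : IsTameHamiltonian H M) (R : ℝ) (x : Plane) :
    HasFDerivAt (truncField H R) (truncFieldDeriv H R x) x := by
  have h1 : HasFDerivAt (fun x => rotDual (fderiv ℝ H x))
      (rotDual ∘L fderiv ℝ (fderiv ℝ H) x) x :=
    rotDual.hasFDerivAt.comp x (h.differentiable_fderiv x).hasFDerivAt
  have h2 : HasFDerivAt (fun x => cutoff (H x / R))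
      ((deriv cutoff (H x / R) / R) • fderiv ℝ H x) x := by
    have hc : HasDerivAt cutoff (deriv cutoff (H x / R)) (H x / R) :=
      ((cutoff_contDiff (n := 1)).differentiable (by norm_num) _).hasDerivAt
    have hd : HasFDerivAt (fun x => H x / R) (R⁻¹ • fderiv ℝ H x) x := by
      simpa [div_eq_inv_mul] using (h.differentiable x).hasFDerivAt.const_mul R⁻¹
    have := hc.comp_hasFDerivAt x hd
    rwa [smul_smul, ← div_eq_mul_inv] at this
  exact h2.smul h1

theorem norm_skew_le (h : IsTameHamiltonian H M) (x : Plane) :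
    ‖rotDual (fderiv ℝ H x)‖ ^ 2 ≤ 4 * M * H x :=
  (pow_le_pow_left₀ (norm_nonneg _) (norm_rotDual_le _) 2).trans (h.norm_fderiv_sq_le x)

theorem norm_truncField_sq_le (h : IsTameHamiltonian H M) (hR : 0 < R) (x : Plane) :
    ‖truncField H R x‖ ^ 2 ≤ 8 * M * R := by
  have hM := h.pos
  by_cases hx : 2 ≤ H x / R
  · rw [truncField, cutoff_eq_zero hx, zero_smul, norm_zero, zero_pow two_ne_zero]
    positivity
  · rw [not_le, div_lt_iff₀ hR] at hx
    rw [truncField, norm_smul, mul_pow, Real.norm_of_nonneg (cutoff_nonneg _)]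
    calc _ ≤ 1 ^ 2 * (4 * M * H x) := by
          gcongr
          · exact cutoff_nonneg _
          · exact cutoff_le_one _
          · exact h.norm_skew_le x
      _ ≤ _ := by nlinarith

/-- The field is tangent to the level sets, so the first-order term of the Taylor expansion vanishes
and only M r² ‖field‖² remains. -/
theorem abs_apply_add_smul_truncField_sub_le (h : IsTameHamiltonian H M) (hR : 0 < R) (r : ℝ)
    (x : Plane) : |H (x + r • truncField H R x) - H x| ≤ 8 * M ^ 2 * R * r ^ 2 := by
  have hM := h.pos
  have := h.abs_taylor_le x (r • truncField H R x)
  rw [map_smul, fderiv_apply_truncField, smul_zero, sub_zero, norm_smul, mul_pow,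
    Real.norm_eq_abs, sq_abs] at this
  refine this.trans ?_
  have := mul_le_mul_of_nonneg_left (h.norm_truncField_sq_le hR x)
    (by positivity : 0 ≤ M * r ^ 2)
  linarith

theorem norm_rotDual_comp_le (h : IsTameHamiltonian H M) (x : Plane) :
    ‖rotDual ∘L fderiv ℝ (fderiv ℝ H) x‖ ≤ M := by
  refine ContinuousLinearMap.opNorm_le_bound _ h.pos.le fun v => ?_
  refine (norm_rotDual_le _).trans ?_
  exact (ContinuousLinearMap.le_opNorm _ v).trans
    (mul_le_mul_of_nonneg_right (h.bound x) (norm_nonneg _))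

/-- Differentiating the cutoff costs a factor 1/R, which is cancelled by |∇H|² ≤ 4MH ≤ 8MR where the
cutoff varies. The bound is therefore independent of R. -/
theorem norm_truncFieldDeriv_le (h : IsTameHamiltonian H M) (hR : 0 < R) {C : ℝ}
    (hC : ∀ z, |deriv cutoff z| ≤ C) (x : Plane) :
    ‖truncFieldDeriv H R x‖ ≤ M + 8 * M * C := by
  have hM := h.pos
  have hC0 : 0 ≤ C := (abs_nonneg _).trans (hC 0)
  refine (norm_add_le _ _).trans (add_le_add ?_ ?_)
  · rw [norm_smul, Real.norm_of_nonneg (cutoff_nonneg _)]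
    calc _ ≤ 1 * M := mul_le_mul (cutoff_le_one _) (h.norm_rotDual_comp_le x) (norm_nonneg _)
            zero_le_one
      _ = M := one_mul _
  · by_cases hx : 2 < H x / R
    · have : 0 ≤ 8 * M * C := by positivity
      simpa [deriv_cutoff_eq_zero hx] using this
    rw [not_lt, div_le_iff₀ hR] at hx
    rw [ContinuousLinearMap.norm_smulRight_apply, norm_smul, norm_div, Real.norm_eq_abs,
      Real.norm_of_nonneg hR.le]
    have h1 : ‖fderiv ℝ H x‖ * ‖rotDual (fderiv ℝ H x)‖ ≤ 8 * M * R :=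
      calc _ ≤ ‖fderiv ℝ H x‖ * ‖fderiv ℝ H x‖ := by gcongr; exact norm_rotDual_le _
        _ ≤ 4 * M * H x := by rw [← sq]; exact h.norm_fderiv_sq_le x
        _ ≤ _ := by nlinarith
    calc _ = |deriv cutoff (H x / R)| / R * (‖fderiv ℝ H x‖ * ‖rotDual (fderiv ℝ H x)‖) := by ring
      _ ≤ C / R * (8 * M * R) := by gcongr; exact hC _
      _ = _ := by field_simp

theorem exists_lipschitz_truncField (h : IsTameHamiltonian H M) :
    ∃ L > (0 : ℝ), ∀ R > (0 : ℝ), ∀ x, ‖truncFieldDeriv H R x‖ ≤ L := by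
  obtain ⟨C, hC0, hC⟩ := exists_deriv_cutoff_le
  have := h.pos
  exact ⟨M + 8 * M * C, by positivity, fun R hR x => h.norm_truncFieldDeriv_le hR hC x⟩

theorem norm_truncField_sub_le (h : IsTameHamiltonian H M) {L : ℝ}
    (hL : ∀ x, ‖truncFieldDeriv H R x‖ ≤ L) (x y : Plane) :
    ‖truncField H R x - truncField H R y‖ ≤ L * ‖x - y‖ :=
  convex_univ.norm_image_sub_le_of_norm_hasFDerivWithin_le
    (fun z _ => (h.hasFDerivAt_truncField R z).hasFDerivWithinAt)
    (fun z _ => hL z) (mem_univ y) (mem_univ x)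

theorem norm_skewGradient_sub_le (h : IsTameHamiltonian H M) (x y : Plane) :
    ‖skewGradient H x - skewGradient H y‖ ≤ M * ‖x - y‖ := by
  rw [skewGradient_eq_rotDual, skewGradient_eq_rotDual, ← map_sub]
  exact (norm_rotDual_le _).trans (h.norm_fderiv_sub_le x y)

/-- The Hessian part is traceless by symmetry of second derivatives. The cutoff depends on x through
H alone, so its gradient is orthogonal to the field and adds no divergence. -/
theorem trace_truncFieldDeriv (h : IsTameHamiltonian H M) (R : ℝ) (x : Plane) :
    truncFieldDeriv H R x (planeBasis 0) 0 + truncFieldDeriv H R x (planeBasis 1) 1 = 0 := by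
  have hs : IsSymmSndFDerivAt ℝ H x :=
    h.contDiff.contDiffAt.isSymmSndFDerivAt (by simp)
  have := hs (planeBasis 0) (planeBasis 1)
  simp only [truncFieldDeriv, _root_.add_apply, _root_.smul_apply,
    ContinuousLinearMap.comp_apply, ContinuousLinearMap.smulRight_apply, PiLp.add_apply,
    PiLp.smul_apply, rotDual_apply_zero, rotDual_apply_one, smul_eq_mul, this]
  ring

end IsTameHamiltonian

theorem det_one_add_smul (A : Plane →L[ℝ] Plane) (r : ℝ) :
    (ContinuousLinearMap.id ℝ Plane + r • A).det =
      1 + r * (A (planeBasis 0) 0 + A (planeBasis 1) 1) +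
        r ^ 2 * (A (planeBasis 0) 0 * A (planeBasis 1) 1 -
          A (planeBasis 1) 0 * A (planeBasis 0) 1) := by
  rw [ContinuousLinearMap.det,
    ← LinearMap.det_toMatrix (EuclideanSpace.basisFun (Fin 2) ℝ).toBasis, Matrix.det_fin_two]
  simp [LinearMap.toMatrix_apply, planeBasis]
  ring

/-- In dimension two a traceless A leaves det(1 + rA) = 1 + r² det A, so an Euler step distorts area
only to second order. -/
theorem one_sub_le_abs_det (A : Plane →L[ℝ] Plane) {L r : ℝ} (hA : ‖A‖ ≤ L)
    (htr : A (planeBasis 0) 0 + A (planeBasis 1) 1 = 0) :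
    1 - 2 * (r * L) ^ 2 ≤ |(ContinuousLinearMap.id ℝ Plane + r • A).det| := by
  have hb : ∀ i j, |A (planeBasis i) j| ≤ L := fun i j =>
    calc _ ≤ ‖A (planeBasis i)‖ := abs_coord_le _ _
      _ ≤ ‖A‖ * ‖planeBasis i‖ := A.le_opNorm _
      _ ≤ L := by rwa [norm_planeBasis, mul_one]
  have hm : ∀ i j k l, |A (planeBasis i) j * A (planeBasis k) l| ≤ L ^ 2 := fun i j k l => by
    rw [abs_mul, sq]
    exact mul_le_mul (hb i j) (hb k l) (abs_nonneg _) ((abs_nonneg _).trans (hb i j))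
  rw [det_one_add_smul, htr]
  refine le_trans ?_ (le_abs_self _)
  have h1 := (abs_le.1 (hm 0 0 1 1)).1
  have h2 := (abs_le.1 (hm 1 0 0 1)).2
  nlinarith [sq_nonneg r]

end Truncation

/-! ### The weight -/

section Weight

/-- A smooth non-decreasing function, equal to `1` for `z ≤ 1` and to `z` for `z ≥ 2`. -/
def smoothMax (z : ℝ) : ℝ := 1 + Real.smoothTransition (z - 1) * (z - 1)

/-- A smooth non-decreasing positive function, equal to `√z` for `z ≥ 2`. -/
def smoothSqrt (z : ℝ) : ℝ := √(smoothMax z)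

theorem one_le_smoothMax (z : ℝ) : 1 ≤ smoothMax z := by
  rw [smoothMax, le_add_iff_nonneg_right]
  rcases le_total z 1 with hz | hz
  · rw [Real.smoothTransition.zero_of_nonpos (by linarith), zero_mul]
  · exact mul_nonneg (Real.smoothTransition.nonneg _) (by linarith)

theorem smoothMax_eq {z : ℝ} (hz : 2 ≤ z) : smoothMax z = z := by
  rw [smoothMax, Real.smoothTransition.one_of_one_le (by linarith)]; ring

theorem monotone_smoothMax : Monotone smoothMax := by
  have hst : Monotone Real.smoothTransition := Real.smoothTransition.monotone
  intro a b hab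
  rcases le_total a 1 with ha | ha
  · have : smoothMax a = 1 := by
      rw [smoothMax, Real.smoothTransition.zero_of_nonpos (by linarith)]; ring
    rw [this]; exact one_le_smoothMax b
  · exact add_le_add_right (mul_le_mul (hst (by linarith)) (by linarith) (by linarith)
      (Real.smoothTransition.nonneg _)) 1

theorem contDiff_smoothSqrt {n : ℕ∞} : ContDiff ℝ n smoothSqrt := by
  have : ContDiff ℝ n smoothMax :=
    contDiff_const.add ((Real.smoothTransition.contDiff.comp (by fun_prop)).mul (by fun_prop))
  exact this.sqrt fun z => (zero_lt_one.trans_le (one_le_smoothMax z)).ne'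

theorem smoothSqrt_eq {z : ℝ} (hz : 2 ≤ z) : smoothSqrt z = √z := by
  rw [smoothSqrt, smoothMax_eq hz]

theorem smoothSqrt_nonneg (z : ℝ) : 0 ≤ smoothSqrt z := Real.sqrt_nonneg _

theorem monotone_smoothSqrt : Monotone smoothSqrt :=
  fun _ _ h => Real.sqrt_le_sqrt (monotone_smoothMax h)

theorem deriv_smoothSqrt {z : ℝ} (hz : 2 < z) : deriv smoothSqrt z = 1 / (2 * √z) := by
  have : smoothSqrt =ᶠ[𝓝 z] Real.sqrt := by
    filter_upwards [lt_mem_nhds hz] with y hy using smoothSqrt_eq hy.le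
  rw [this.deriv_eq, (Real.hasDerivAt_sqrt (by linarith)).deriv]

theorem deriv_deriv_smoothSqrt {z : ℝ} (hz : 2 < z) :
    deriv (deriv smoothSqrt) z = -(1 / (4 * z * √z)) := by
  have h0 : 0 < z := by linarith
  have hs : 0 < √z := Real.sqrt_pos.2 h0
  have : deriv smoothSqrt =ᶠ[𝓝 z] fun y => (2 * √y)⁻¹ := by
    filter_upwards [lt_mem_nhds hz] with y hy
    rw [deriv_smoothSqrt hy, one_div]
  rw [this.deriv_eq]
  have hd : HasDerivAt (fun y => (2 * √y)⁻¹) (-(2 * (1 / (2 * √z))) / (2 * √z) ^ 2) z :=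
    ((Real.hasDerivAt_sqrt h0.ne').const_mul 2).inv (by positivity)
  rw [hd.deriv, mul_pow, Real.sq_sqrt h0.le]
  field_simp
  norm_num

/-- These are the products that occur when `smoothSqrt ∘ H` is differentiated: s' meets the bounded
Hessian, s' meets |∇H| = O(√H), and s'' meets |∇H|² = O(H). Compactness covers [0, 2]; explicit
formulas cover the rest. -/
theorem exists_smoothSqrt_bounds : ∃ K > (0 : ℝ), ∀ z, 0 ≤ z → |deriv smoothSqrt z| ≤ K ∧
    |deriv smoothSqrt z| * √z ≤ K ∧ |deriv (deriv smoothSqrt) z| * z ≤ K := by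
  have hc : Continuous (deriv smoothSqrt) :=
    (contDiff_smoothSqrt (n := 1)).continuous_deriv le_rfl
  have hd : ContDiff ℝ 1 (deriv smoothSqrt) :=
    ((contDiff_succ_iff_deriv (n := 1)).1 (contDiff_smoothSqrt (n := 2))).2.2
  have hc' : Continuous (deriv (deriv smoothSqrt)) := hd.continuous_deriv le_rfl
  have key : ∀ F : ℝ → ℝ, Continuous F → ∃ C, ∀ z ∈ Icc (0 : ℝ) 2, ‖F z‖ ≤ C := fun F hF =>
    isCompact_Icc.exists_bound_of_continuousOn hF.continuousOn
  obtain ⟨C₁, h₁⟩ := key _ hc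
  obtain ⟨C₂, h₂⟩ := key (fun z => deriv smoothSqrt z * √z) (by fun_prop)
  obtain ⟨C₃, h₃⟩ := key (fun z => deriv (deriv smoothSqrt) z * z) (by fun_prop)
  refine ⟨max 1 (max C₁ (max C₂ C₃)), by positivity, fun z hz => ?_⟩
  rcases le_or_gt z 2 with h2 | h2
  · have h₁ := h₁ z ⟨hz, h2⟩
    have h₂ := h₂ z ⟨hz, h2⟩
    have h₃ := h₃ z ⟨hz, h2⟩
    rw [norm_mul, Real.norm_eq_abs, Real.norm_of_nonneg (Real.sqrt_nonneg _)] at h₂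
    rw [norm_mul, Real.norm_eq_abs, Real.norm_of_nonneg hz] at h₃
    exact ⟨h₁.trans (by simp), h₂.trans (by simp), h₃.trans (by simp)⟩
  · have hs : 1 ≤ √z := Real.one_le_sqrt.2 (by linarith)
    have e2 : |-(1 / (4 * z * √z))| = 1 / (4 * z * √z) := by
      rw [abs_neg, abs_of_nonneg (by positivity)]
    rw [deriv_smoothSqrt h2, deriv_deriv_smoothSqrt h2, e2, abs_of_nonneg (by positivity)]
    refine ⟨le_trans ?_ (le_max_left _ _), le_trans ?_ (le_max_left _ _),
      le_trans ?_ (le_max_left _ _)⟩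
    · rw [div_le_one (by positivity)]; linarith
    · field_simp; norm_num
    · field_simp; linarith

/-- The weight as a function of the value of the Hamiltonian. -/
def profile (lam z : ℝ) : ℝ := Real.exp (-lam * smoothSqrt z)

theorem profile_pos (lam z : ℝ) : 0 < profile lam z := Real.exp_pos _

theorem contDiff_profile (lam : ℝ) {n : ℕ∞} : ContDiff ℝ n (profile lam) :=
  (contDiff_const.mul contDiff_smoothSqrt).exp

theorem antitone_profile {lam : ℝ} (hlam : 0 < lam) : Antitone (profile lam) := fun a b hab =>
  Real.exp_le_exp.2 (by nlinarith [monotone_smoothSqrt hab])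

theorem profile_le_one {lam : ℝ} (hlam : 0 < lam) (z : ℝ) : profile lam z ≤ 1 :=
  Real.exp_le_one_iff.2 (by nlinarith [smoothSqrt_nonneg z])

/-- The logarithm of the profile is Lipschitz on the half-line. This serves both the drift step and
the comparison of the weight with its value at an integer level. -/
theorem exists_profile_le_exp_mul {lam : ℝ} (hlam : 0 < lam) : ∃ K > (0 : ℝ), ∀ z z', 0 ≤ z →
    0 ≤ z' → profile lam z ≤ Real.exp (K * |z - z'|) * profile lam z' := by
  obtain ⟨K, hK, h⟩ := exists_smoothSqrt_bounds
  refine ⟨lam * K, by positivity, fun z z' hz hz' => ?_⟩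
  have := (convex_Ici (0 : ℝ)).norm_image_sub_le_of_norm_deriv_le (f := smoothSqrt)
    (fun x _ => (contDiff_smoothSqrt (n := 1)).differentiable (by norm_num) x)
    (fun x hx => (h x hx).1) hz hz'
  rw [Real.norm_eq_abs, Real.norm_eq_abs] at this
  rw [profile, profile, ← Real.exp_add]
  refine Real.exp_le_exp.2 ?_
  rw [abs_sub_comm] at this ⊢
  rw [abs_sub_comm z' z] at *
  have h2 := (abs_le.1 this).1
  nlinarith

end Weight

/-! ### Second-order expansion and integrability of the weight. -/

section WeightTaylor

theorem le_add_deriv_add_of_abs_deriv_deriv_le {F F' F'' : ℝ → ℝ} {B : ℝ}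
    (h1 : ∀ s, HasDerivAt F (F' s) s) (h2 : ∀ s, HasDerivAt F' (F'' s) s)
    (hB : ∀ s ∈ Icc (0 : ℝ) 1, |F'' s| ≤ B) : F 1 ≤ F 0 + F' 0 + B := by
  have hB0 : 0 ≤ B := (abs_nonneg _).trans (hB 0 (by simp))
  have hF' : ∀ s ∈ Icc (0 : ℝ) 1, ‖F' s - F' 0‖ ≤ B := fun s hs => by
    have := (convex_Icc (0 : ℝ) 1).norm_image_sub_le_of_norm_hasDerivWithin_le
      (fun z _ => (h2 z).hasDerivWithinAt) hB (left_mem_Icc.2 zero_le_one) hs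
    refine this.trans ?_
    rw [sub_zero, Real.norm_of_nonneg hs.1]
    exact mul_le_of_le_one_right hB0 hs.2
  have := (convex_Icc (0 : ℝ) 1).norm_image_sub_le_of_norm_hasDerivWithin_le
    (f := fun s => F s - F' 0 * s) (f' := fun s => F' s - F' 0)
    (fun z _ => (((h1 z).sub ((hasDerivAt_id' z).const_mul (F' 0))).congr_deriv
      (by simp)).hasDerivWithinAt) hF'
    (left_mem_Icc.2 zero_le_one) (right_mem_Icc.2 zero_le_one)
  simp only [mul_one, mul_zero, sub_zero, norm_one] at this
  linarith [(abs_le.1 this).2]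

variable {H : Plane → ℝ} {M : ℝ}

theorem IsTameHamiltonian.norm_fderiv_le (h : IsTameHamiltonian H M) (x : Plane) :
    ‖fderiv ℝ H x‖ ≤ 2 * √M * √(H x) := by
  have := Real.le_sqrt_of_sq_le (h.norm_fderiv_sq_le x)
  rwa [Real.sqrt_mul (by have := h.pos; positivity), Real.sqrt_mul (by norm_num),
    show (4 : ℝ) = 2 ^ 2 by norm_num, Real.sqrt_sq (by norm_num)] at this

/-- One-dimensional form of the Taylor bound along a segment: φ is H on the segment, ψ and χ are its
first two derivatives, Y is the length of the segment. -/
theorem profile_le_of_abs_deriv_le {K M Y lam : ℝ} {φ ψ χ : ℝ → ℝ}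
    (hb : ∀ z, 0 ≤ z → |deriv smoothSqrt z| ≤ K ∧
      |deriv smoothSqrt z| * √z ≤ K ∧ |deriv (deriv smoothSqrt) z| * z ≤ K)
    (hK : 0 < K) (hM : 0 < M) (hY : 0 ≤ Y) (hlam : 0 < lam)
    (dφ : ∀ s, HasDerivAt φ (ψ s) s) (dψ : ∀ s, HasDerivAt ψ (χ s) s)
    (bφ : ∀ s, 0 ≤ φ s) (bψ : ∀ s, |ψ s| ≤ 2 * √M * √(φ s) * Y)
    (bχ : ∀ s, |χ s| ≤ M * Y ^ 2) :
    profile lam (φ 1) ≤ profile lam (φ 0) * (1 + -lam * deriv smoothSqrt (φ 0) * ψ 0 +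
      (lam * (5 * M * K) + lam ^ 2 * (2 * √M * K) ^ 2) *
        (Y ^ 2 * Real.exp (lam * (2 * √M * K) * Y))) := by
  have dg : ∀ z, HasDerivAt smoothSqrt (deriv smoothSqrt z) z := fun z =>
    ((contDiff_smoothSqrt (n := 1)).differentiable (by norm_num) z).hasDerivAt
  have dg' : ∀ z, HasDerivAt (deriv smoothSqrt) (deriv (deriv smoothSqrt) z) z := fun z =>
    ((((contDiff_succ_iff_deriv (n := 1)).1
      (contDiff_smoothSqrt (n := 2))).2.2).differentiable (by norm_num) z).hasDerivAt
  obtain ⟨K₁, hK₁⟩ : ∃ K₁, K₁ = 2 * √M * K := ⟨_, rfl⟩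
  rw [← hK₁]
  have hK₁pos : 0 < K₁ := by rw [hK₁]; positivity
  obtain ⟨q', hq'⟩ : ∃ q' : ℝ → ℝ, ∀ s, q' s = deriv smoothSqrt (φ s) * ψ s := ⟨_, fun _ => rfl⟩
  obtain ⟨q'', hq''⟩ : ∃ q'' : ℝ → ℝ, ∀ s, q'' s = deriv (deriv smoothSqrt) (φ s) * ψ s * ψ s +
    deriv smoothSqrt (φ s) * χ s := ⟨_, fun _ => rfl⟩
  have dq : ∀ s, HasDerivAt (fun s => smoothSqrt (φ s)) (q' s) s := fun s =>
    ((dg (φ s)).comp s (dφ s)).congr_deriv (hq' s).symm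
  have dq' : ∀ s, HasDerivAt q' (q'' s) s := fun s => by
    rw [funext hq', hq'']
    exact ((dg' (φ s)).comp s (dφ s)).mul (dψ s)
  have bq' : ∀ s, |q' s| ≤ K₁ * Y := fun s => by
    rw [hq', abs_mul, hK₁]
    calc _ ≤ |deriv smoothSqrt (φ s)| * (2 * √M * √(φ s) * Y) := by gcongr; exact bψ s
      _ = 2 * √M * (|deriv smoothSqrt (φ s)| * √(φ s)) * Y := by ring
      _ ≤ 2 * √M * K * Y := by gcongr; exact (hb _ (bφ s)).2.1
  -- The 5 is 4 + 1: the term s''ψ² gives 4MK Y² and the term s'χ gives MK Y².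
  have bq'' : ∀ s, |q'' s| ≤ 5 * M * K * Y ^ 2 := fun s => by
    have h1 : |ψ s| * |ψ s| ≤ 4 * M * φ s * Y ^ 2 :=
      calc _ ≤ (2 * √M * √(φ s) * Y) * (2 * √M * √(φ s) * Y) :=
            mul_le_mul (bψ s) (bψ s) (abs_nonneg _) (by positivity)
        _ = 4 * (√M) ^ 2 * (√(φ s)) ^ 2 * Y ^ 2 := by ring
        _ = _ := by rw [Real.sq_sqrt hM.le, Real.sq_sqrt (bφ s)]
    rw [hq'']
    refine (abs_add_le _ _).trans ?_
    rw [abs_mul, abs_mul, abs_mul, mul_assoc]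
    calc _ ≤ |deriv (deriv smoothSqrt) (φ s)| * (4 * M * φ s * Y ^ 2) +
          K * (M * Y ^ 2) :=
          add_le_add (mul_le_mul_of_nonneg_left h1 (abs_nonneg _))
            (mul_le_mul (hb _ (bφ s)).1 (bχ s) (abs_nonneg _) hK.le)
      _ = 4 * M * (|deriv (deriv smoothSqrt) (φ s)| * φ s) * Y ^ 2 + K * (M * Y ^ 2) := by ring
      _ ≤ 4 * M * K * Y ^ 2 + K * (M * Y ^ 2) := by
            gcongr; exact (hb _ (bφ s)).2.2
      _ = _ := by ring
  obtain ⟨F, hF⟩ : ∃ F : ℝ → ℝ, ∀ s, F s = Real.exp (-lam * smoothSqrt (φ s)) :=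
    ⟨_, fun _ => rfl⟩
  have Fpos : ∀ s, 0 < F s := fun s => by rw [hF]; exact Real.exp_pos _
  have dF : ∀ s, HasDerivAt F (F s * (-lam * q' s)) s := fun s => by
    rw [hF s, funext hF]
    exact ((dq s).const_mul (-lam)).exp
  have dF' : ∀ s, HasDerivAt (fun s => F s * (-lam * q' s))
      (F s * (-lam * q' s) * (-lam * q' s) + F s * (-lam * q'' s)) s := fun s =>
    (dF s).mul ((dq' s).const_mul (-lam))
  -- Comparing F s with F 0 makes the remainder relative to the weight at the base point; this
  -- produces the exponential factor in Y.
  have bF : ∀ s ∈ Icc (0 : ℝ) 1, F s ≤ F 0 * Real.exp (lam * K₁ * Y) := fun s hs => by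
    have := convex_univ.norm_image_sub_le_of_norm_hasDerivWithin_le
      (fun z _ => (dq z).hasDerivWithinAt) (fun z _ => bq' z) (mem_univ (0 : ℝ)) (mem_univ s)
    rw [sub_zero, Real.norm_of_nonneg hs.1] at this
    have h1 := (abs_le.1 (this.trans (mul_le_of_le_one_right (by positivity) hs.2))).1
    rw [hF, hF, ← Real.exp_add]
    exact Real.exp_le_exp.2 (by nlinarith)
  have key := le_add_deriv_add_of_abs_deriv_deriv_le dF dF'
    (B := F 0 * Real.exp (lam * K₁ * Y) *
      ((lam * (5 * M * K) + lam ^ 2 * K₁ ^ 2) * Y ^ 2)) (fun s hs => by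
        rw [show F s * (-lam * q' s) * (-lam * q' s) + F s * (-lam * q'' s) =
          F s * (lam ^ 2 * q' s ^ 2 - lam * q'' s) by ring, abs_mul,
          abs_of_nonneg (Fpos s).le]
        refine mul_le_mul (bF s hs) ?_ (abs_nonneg _) (mul_pos (Fpos 0) (Real.exp_pos _)).le
        refine (abs_sub _ _).trans ?_
        rw [abs_mul, abs_mul, abs_pow, abs_pow, abs_of_pos hlam]
        have h1 := mul_le_mul_of_nonneg_left (bq'' s) hlam.le
        have h3 : lam ^ 2 * |q' s| ^ 2 ≤ lam ^ 2 * (K₁ * Y) ^ 2 := by gcongr; exact bq' s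
        linarith)
  simp only [hF, hq'] at key
  rw [profile, profile]
  refine key.trans (le_of_eq ?_)
  ring

/-- Only C and K have to be uniform in x. The coefficient a needs no bound, since the linear term
will be averaged against a centred law. -/
theorem IsTameHamiltonian.exists_profile_taylor (h : IsTameHamiltonian H M) {lam : ℝ}
    (hlam : 0 < lam) : ∃ C > (0 : ℝ), ∃ K > (0 : ℝ), ∀ x, ∃ a : ℝ, ∀ y,
      profile lam (H (x + y)) ≤ profile lam (H x) *
        (1 + a * fderiv ℝ H x y + C * (‖y‖ ^ 2 * Real.exp (K * ‖y‖))) := by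
  obtain ⟨K, hK, hb⟩ := exists_smoothSqrt_bounds
  have hM := h.pos
  refine ⟨lam * (5 * M * K) + lam ^ 2 * (2 * √M * K) ^ 2, by positivity, lam * (2 * √M * K),
    by positivity, fun x => ⟨-lam * deriv smoothSqrt (H x), fun y => ?_⟩⟩
  have hline : ∀ s : ℝ, HasDerivAt (fun s : ℝ => x + s • y) y s := fun s => by
    simpa using ((hasDerivAt_id s).smul_const y).const_add x
  have dφ : ∀ s : ℝ, HasDerivAt (fun s : ℝ => H (x + s • y)) (fderiv ℝ H (x + s • y) y) s :=
    fun s => (h.differentiable (x + s • y)).hasFDerivAt.comp_hasDerivAt s (hline s)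
  have dψ : ∀ s : ℝ, HasDerivAt (fun s : ℝ => fderiv ℝ H (x + s • y) y)
      (fderiv ℝ (fderiv ℝ H) (x + s • y) y y) s := fun s => by
    have h1 := (h.differentiable_fderiv (x + s • y)).hasFDerivAt.comp_hasDerivAt s (hline s)
    have h2 := h1.clm_apply (hasDerivAt_const s y)
    simpa using h2
  have bψ : ∀ s : ℝ, |fderiv ℝ H (x + s • y) y| ≤ 2 * √M * √(H (x + s • y)) * ‖y‖ := fun s =>
    ((fderiv ℝ H (x + s • y)).le_opNorm y).trans
      (mul_le_mul_of_nonneg_right (h.norm_fderiv_le _) (norm_nonneg _))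
  have bχ : ∀ s : ℝ, |fderiv ℝ (fderiv ℝ H) (x + s • y) y y| ≤ M * ‖y‖ ^ 2 := fun s => by
    refine (ContinuousLinearMap.le_opNorm₂ (fderiv ℝ (fderiv ℝ H) (x + s • y)) y y).trans ?_
    rw [mul_assoc, ← sq]
    exact mul_le_mul_of_nonneg_right (h.bound _) (by positivity)
  have := profile_le_of_abs_deriv_le hb hK hM (norm_nonneg y) hlam dφ dψ (fun s => h.nonneg _)
    bψ bχ
  simpa only [zero_smul, one_smul, add_zero] using this

/-- The weight on the plane. -/
def weight (H : Plane → ℝ) (lam : ℝ) (x : Plane) : ℝ≥0∞ := ENNReal.ofReal (profile lam (H x))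

theorem IsTameHamiltonian.measurable_weight (h : IsTameHamiltonian H M) (lam : ℝ) :
    Measurable (weight H lam) :=
  (((contDiff_profile (n := 1) lam).continuous.comp h.continuous).measurable).ennreal_ofReal

/-- Quadratic growth of H turns the weight into at most exp(-λ√a ‖x‖) far out. It is compared with
(1 + ‖x‖)^{-3}, which is integrable in the plane because 3 > 2. -/
theorem lintegral_weight_lt_top {lam a R : ℝ}
    (hlam : 0 < lam) (ha : 0 < a) (hgr : ∀ x : Plane, R ≤ ‖x‖ → a * ‖x‖ ^ 2 ≤ H x) :
    ∫⁻ x, weight H lam x < ∞ := by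
  obtain ⟨D, hD0, hD⟩ : ∃ D > (0 : ℝ), ∀ x : Plane,
      profile lam (H x) ≤ D * (1 + ‖x‖) ^ (-(3 : ℝ)) := by
    set b := lam * √a with hb
    have hbpos : 0 < b := by positivity
    -- Beyond √(2/a) the growth bound gives H ≥ 2, where `smoothSqrt` is the true square root.
    set R' := max R (√(2 / a)) with hR'
    refine ⟨max ((1 + R') ^ (3 : ℝ)) (6 * Real.exp b / b ^ 3), by positivity, fun x => ?_⟩
    have hx1 : 0 < 1 + ‖x‖ := by positivity
    rw [Real.rpow_neg hx1.le, ← div_eq_mul_inv, le_div_iff₀ (by positivity)]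
    rcases le_total ‖x‖ R' with hx | hx
    · refine le_trans ?_ (le_max_left _ _)
      calc _ ≤ 1 * (1 + R') ^ (3 : ℝ) := by
            gcongr
            exact profile_le_one hlam _
        _ = _ := one_mul _
    · refine le_trans ?_ (le_max_right _ _)
      have hx2 : √(2 / a) ≤ ‖x‖ := (le_max_right _ _).trans hx
      have hx3 : 2 ≤ a * ‖x‖ ^ 2 := by
        have := pow_le_pow_left₀ (Real.sqrt_nonneg _) hx2 2
        rw [Real.sq_sqrt (by positivity), div_le_iff₀ ha] at this
        linarith
      have hHx := hgr x ((le_max_left _ _).trans hx)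
      have h1 : profile lam (H x) ≤ Real.exp (-(b * ‖x‖)) := by
        rw [profile, smoothSqrt_eq (hx3.trans hHx)]
        have : √a * ‖x‖ ≤ √(H x) := by
          rw [← Real.sqrt_sq (norm_nonneg x), ← Real.sqrt_mul ha.le]
          exact Real.sqrt_le_sqrt hHx
        refine Real.exp_le_exp.2 ?_
        rw [hb]
        nlinarith
      have h2 : (b * (1 + ‖x‖)) ^ 3 / 6 ≤ Real.exp (b * (1 + ‖x‖)) := by
        have := Real.pow_div_factorial_le_exp (x := b * (1 + ‖x‖)) (by positivity) 3
        simpa [Nat.factorial] using this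
      rw [show ((1 + ‖x‖) ^ (3 : ℝ)) = (1 + ‖x‖) ^ 3 by norm_cast, le_div_iff₀ (by positivity)]
      calc profile lam (H x) * (1 + ‖x‖) ^ 3 * b ^ 3
          = profile lam (H x) * ((b * (1 + ‖x‖)) ^ 3 / 6 * 6) := by ring
        _ ≤ Real.exp (-(b * ‖x‖)) * (Real.exp (b * (1 + ‖x‖)) * 6) := by
            gcongr
        _ = 6 * Real.exp b := by
            rw [← mul_assoc, ← Real.exp_add]; ring_nf
  have hint : Integrable (fun x : Plane => D * (1 + ‖x‖) ^ (-(3 : ℝ))) :=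
    (integrable_one_add_norm (by simp; norm_num)).const_mul D
  calc ∫⁻ x, weight H lam x ≤ ∫⁻ x : Plane, ENNReal.ofReal (D * (1 + ‖x‖) ^ (-(3 : ℝ))) :=
        lintegral_mono fun x => ENNReal.ofReal_le_ofReal (hD x)
    _ < ∞ := hint.lintegral_lt_top

end WeightTaylor

/-! ### Gaussian increments -/

section Gaussian

/-- The centered Gaussian law on the plane with covariance `δ` times the identity. -/
def gaussPlane (δ : ℝ≥0) : Measure Plane := (stdGaussian Plane).map fun y => √(δ : ℝ) • y

instance (δ : ℝ≥0) : IsProbabilityMeasure (gaussPlane δ) :=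
  Measure.isProbabilityMeasure_map (by fun_prop)

theorem map_pi_gaussianReal_eq_gaussPlane (δ : ℝ≥0) :
    (Measure.pi fun _ : Fin 2 => gaussianReal 0 δ).map (WithLp.toLp 2) = gaussPlane δ := by
  have h1 : gaussianReal 0 δ = (gaussianReal 0 1).map (√(δ : ℝ) * ·) := by
    rw [gaussianReal_map_const_mul]
    congr 1
    · simp
    · ext; simp
  have h2 : (Measure.pi fun _ : Fin 2 => gaussianReal 0 δ) =
      (Measure.pi fun _ : Fin 2 => gaussianReal 0 1).map (fun x i => √(δ : ℝ) * x i) := by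
    rw [h1, Measure.pi_map_pi (fun _ => by fun_prop)]
  rw [h2, gaussPlane, ← map_pi_eq_stdGaussian, Measure.map_map (by fun_prop) (by fun_prop),
    Measure.map_map (by fun_prop) (by fun_prop)]
  rfl

/-- Completing the square in C t² - (K+1) t; the extra 1 in the exponent absorbs t² ≤ 2 e^t. With
Fernique's theorem this makes the Taylor remainder integrable. -/
theorem sq_mul_exp_le {C : ℝ} (hC : 0 < C) (K : ℝ) {t : ℝ} (ht : 0 ≤ t) :
    t ^ 2 * Real.exp (K * t) ≤ 2 * Real.exp ((K + 1) ^ 2 / (4 * C)) * Real.exp (C * t ^ 2) := by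
  have h1 : t ^ 2 ≤ 2 * Real.exp t := by
    have := Real.pow_div_factorial_le_exp t ht 2
    norm_num [Nat.factorial] at this
    linarith
  calc t ^ 2 * Real.exp (K * t) ≤ 2 * Real.exp t * Real.exp (K * t) := by gcongr
    _ = 2 * Real.exp ((K + 1) * t) := by rw [mul_assoc, ← Real.exp_add]; ring_nf
    _ ≤ 2 * Real.exp ((K + 1) ^ 2 / (4 * C) + C * t ^ 2) := by
        gcongr
        have : (K + 1) ^ 2 / (4 * C) + C * t ^ 2 - (K + 1) * t =
            (K + 1 - 2 * C * t) ^ 2 / (4 * C) := by field_simp; ring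
        have h2 : 0 ≤ (K + 1 - 2 * C * t) ^ 2 / (4 * C) := by positivity
        linarith
    _ = _ := by rw [Real.exp_add, mul_assoc]

theorem integrable_sq_mul_exp_stdGaussian (K : ℝ) :
    Integrable (fun y => ‖y‖ ^ 2 * Real.exp (K * ‖y‖)) (stdGaussian Plane) := by
  obtain ⟨C, hC, hi⟩ := IsGaussian.exists_integrable_exp_sq (stdGaussian Plane)
  refine (hi.const_mul (2 * Real.exp ((K + 1) ^ 2 / (4 * C)))).mono' (by fun_prop)
    (Eventually.of_forall fun y => ?_)
  rw [Real.norm_of_nonneg (by positivity)]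
  exact sq_mul_exp_le hC K (norm_nonneg y)

variable {H : Plane → ℝ} {M : ℝ}

/-- After scaling by √δ the linear term of the expansion has mean zero and the remainder is of order
δ, so the factor is at most 1 + cδ. -/
theorem IsTameHamiltonian.exists_lintegral_weight_gaussPlane_le (h : IsTameHamiltonian H M)
    {lam : ℝ} (hlam : 0 < lam) : ∃ c > (0 : ℝ), ∀ δ : ℝ≥0, δ ≤ 1 → ∀ x,
      ∫⁻ y, weight H lam (x - y) ∂gaussPlane δ ≤
        ENNReal.ofReal (Real.exp (c * δ)) * weight H lam x := by
  obtain ⟨C, hC, K, hK, hT⟩ := h.exists_profile_taylor hlam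
  have hint := integrable_sq_mul_exp_stdGaussian K
  set I := ∫ y, ‖y‖ ^ 2 * Real.exp (K * ‖y‖) ∂stdGaussian Plane with hI
  have hI0 : 0 ≤ I := integral_nonneg fun y => by positivity
  -- The summand 1 only secures strict positivity. The assumption δ ≤ 1 keeps the exponential in the
  -- remainder independent of δ.
  refine ⟨C * I + 1, by positivity, fun δ hδ x => ?_⟩
  obtain ⟨a, ha⟩ := hT x
  have hs1 : √(δ : ℝ) ≤ 1 := Real.sqrt_le_one.2 (by exact_mod_cast hδ)
  have hs0 := Real.sqrt_nonneg (δ : ℝ)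
  have hpos := (profile_pos lam (H x)).le
  set G : Plane → ℝ := fun y => profile lam (H x) * (1 + (-a * √(δ : ℝ)) * fderiv ℝ H x y +
    (C * δ) * (‖y‖ ^ 2 * Real.exp (K * ‖y‖))) with hG
  have hfG : ∀ y, profile lam (H (x - √(δ : ℝ) • y)) ≤ G y := fun y => by
    have h1 := ha (-(√(δ : ℝ) • y))
    rw [← sub_eq_add_neg] at h1
    refine h1.trans (mul_le_mul_of_nonneg_left ?_ hpos)
    rw [map_neg, map_smul, smul_eq_mul, norm_neg, norm_smul, Real.norm_of_nonneg hs0, mul_pow,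
      Real.sq_sqrt δ.coe_nonneg]
    have h2 : Real.exp (K * (√(δ : ℝ) * ‖y‖)) ≤ Real.exp (K * ‖y‖) := by
      gcongr
      exact mul_le_of_le_one_left (norm_nonneg _) hs1
    have h3 : C * (δ * ‖y‖ ^ 2 * Real.exp (K * (√(δ : ℝ) * ‖y‖))) ≤
        C * δ * (‖y‖ ^ 2 * Real.exp (K * ‖y‖)) := by
      rw [mul_assoc C, mul_assoc (δ : ℝ)]
      gcongr
    linarith
  have hlin : Integrable (fun y => fderiv ℝ H x y) (stdGaussian Plane) :=
    (fderiv ℝ H x).integrable_comp IsGaussian.integrable_id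
  have hlin0 : ∫ y, fderiv ℝ H x y ∂stdGaussian Plane = 0 :=
    integral_strongDual_stdGaussian (fderiv ℝ H x)
  have i1 : Integrable (fun y => 1 + (-a * √(δ : ℝ)) * fderiv ℝ H x y) (stdGaussian Plane) :=
    (integrable_const 1).add (hlin.const_mul _)
  have hGi : Integrable G (stdGaussian Plane) := (i1.add (hint.const_mul _)).const_mul _
  have hGint : ∫ y, G y ∂stdGaussian Plane = profile lam (H x) * (1 + C * δ * I) := by
    rw [hG, integral_const_mul, integral_add i1 (hint.const_mul _),
      integral_add (integrable_const 1) (hlin.const_mul _), integral_const_mul,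
      integral_const_mul, hlin0]
    simp [hI]
  rw [gaussPlane, lintegral_map (f := fun y => weight H lam (x - y))
    ((h.measurable_weight lam).comp (by fun_prop)) (by fun_prop)]
  calc ∫⁻ y, weight H lam (x - √(δ : ℝ) • y) ∂stdGaussian Plane
      ≤ ∫⁻ y, ENNReal.ofReal (G y) ∂stdGaussian Plane :=
        lintegral_mono fun y => ENNReal.ofReal_le_ofReal (hfG y)
    _ = ENNReal.ofReal (∫ y, G y ∂stdGaussian Plane) :=
        (ofReal_integral_eq_lintegral_ofReal hGi (Eventually.of_forall fun y =>
          (profile_pos _ _).le.trans (hfG y))).symm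
    _ ≤ ENNReal.ofReal (Real.exp ((C * I + 1) * δ) * profile lam (H x)) := by
        rw [hGint, mul_comm]
        refine ENNReal.ofReal_le_ofReal (mul_le_mul_of_nonneg_right ?_ hpos)
        refine le_trans ?_ (Real.add_one_le_exp _)
        have := δ.coe_nonneg
        linarith
    _ = _ := by rw [ENNReal.ofReal_mul (Real.exp_pos _).le]; rfl

/-- Translation invariance of the Lebesgue measure lets a Gaussian convolution act on either
factor of a product. -/
theorem lintegral_mul_lintegral_add_gaussPlane (δ : ℝ≥0) {f g : Plane → ℝ≥0∞} (hf : Measurable f)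
    (hg : Measurable g) :
    ∫⁻ x, f x * ∫⁻ y, g (x + y) ∂gaussPlane δ = ∫⁻ x, g x * ∫⁻ y, f (x - y) ∂gaussPlane δ := by
  calc ∫⁻ x, f x * ∫⁻ y, g (x + y) ∂gaussPlane δ
      = ∫⁻ x, ∫⁻ y, f x * g (x + y) ∂gaussPlane δ :=
        lintegral_congr fun x => (lintegral_const_mul _ (by fun_prop)).symm
    _ = ∫⁻ y, (∫⁻ x, f x * g (x + y)) ∂gaussPlane δ :=
        lintegral_lintegral_swap (f := fun x y => f x * g (x + y))
          (show Measurable fun p : Plane × Plane => f p.1 * g (p.1 + p.2) by fun_prop).aemeasurable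
    _ = ∫⁻ y, (∫⁻ x, f (x - y) * g x) ∂gaussPlane δ := by
        refine lintegral_congr fun y => ?_
        rw [← lintegral_add_right_eq_self (fun x => f (x - y) * g x) y]
        simp
    _ = ∫⁻ x, ∫⁻ y, f (x - y) * g x ∂gaussPlane δ :=
        (lintegral_lintegral_swap (f := fun x y => f (x - y) * g x)
          (show Measurable fun p : Plane × Plane =>
            f (p.1 - p.2) * g p.1 by fun_prop).aemeasurable).symm
    _ = _ := lintegral_congr fun x => by
        rw [lintegral_mul_const _ (by fun_prop), mul_comm]

end Gaussian

/-! ### One step of the splitting scheme -/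

section Step

variable {H : Plane → ℝ} {M : ℝ}

/-- Change of variables under x ↦ x + r·field. Tangency makes the change of weight second order in
r, vanishing divergence does the same for the Jacobian. -/
theorem IsTameHamiltonian.exists_lintegral_weight_drift_le (h : IsTameHamiltonian H M)
    {lam : ℝ} (hlam : 0 < lam) : ∃ κ > (0 : ℝ), ∃ r₀ > (0 : ℝ), ∀ R ≥ (1 : ℝ), ∀ r : ℝ, |r| ≤ r₀ →
      ∀ g : Plane → ℝ≥0∞, ∫⁻ x, weight H lam x * g (x + r • truncField H R x) ≤
        ENNReal.ofReal (Real.exp (κ * R * r ^ 2)) * ∫⁻ x, weight H lam x * g x := by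
  obtain ⟨K, hK, hprof⟩ := exists_profile_le_exp_mul hlam
  obtain ⟨L, hL0, hL⟩ := h.exists_lipschitz_truncField
  have hM := h.pos
  -- The first summand pays for the change of H, the second for the Jacobian. The bound on r gives
  -- |r|L ≤ 1/2, hence injectivity.
  refine ⟨K * (8 * M ^ 2) + 4 * L ^ 2, by positivity, 1 / (2 * L), by positivity,
    fun R hR r hr g => ?_⟩
  have hR0 : 0 < R := by linarith
  have hrL : |r| * L ≤ 1 / 2 := by
    rw [le_div_iff₀ (by positivity)] at hr
    linarith
  have hrL2 : (r * L) ^ 2 ≤ 1 / 4 := by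
    rw [← sq_abs, abs_mul, abs_of_pos hL0]
    have : 0 ≤ |r| * L := by positivity
    nlinarith
  set ψ : Plane → Plane := fun x => x + r • truncField H R x with hψ
  set D : Plane → Plane →L[ℝ] Plane := fun x =>
    ContinuousLinearMap.id ℝ Plane + r • truncFieldDeriv H R x with hD
  have hder : ∀ x ∈ (univ : Set Plane), HasFDerivWithinAt ψ (D x) univ x := fun x _ =>
    ((hasFDerivAt_id x).add ((h.hasFDerivAt_truncField R x).const_smul r)).hasFDerivWithinAt
  have hinj : InjOn ψ univ := fun x _ y _ hxy => by
    by_contra hne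
    have h1 : x - y = r • (truncField H R y - truncField H R x) := by
      rw [smul_sub, sub_eq_sub_iff_add_eq_add, add_comm (r • truncField H R y)]
      exact hxy
    have h2 : ‖x - y‖ ≤ 1 / 2 * ‖x - y‖ := by
      conv_lhs => rw [h1]
      rw [norm_smul, Real.norm_eq_abs, norm_sub_rev]
      calc |r| * ‖truncField H R x - truncField H R y‖ ≤ |r| * (L * ‖x - y‖) := by
            gcongr; exact h.norm_truncField_sub_le (hL R hR0) x y
        _ = |r| * L * ‖x - y‖ := by ring
        _ ≤ _ := by gcongr
    have h3 : 0 < ‖x - y‖ := norm_pos_iff.2 (sub_ne_zero.2 hne)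
    linarith
  have hpt : ∀ x, weight H lam x * g (ψ x) ≤
      ENNReal.ofReal (Real.exp ((K * (8 * M ^ 2) + 4 * L ^ 2) * R * r ^ 2)) *
        (ENNReal.ofReal |(D x).det| * (weight H lam (ψ x) * g (ψ x))) := fun x => by
    rw [← mul_assoc, ← mul_assoc]
    refine mul_le_mul_left ?_ _
    rw [weight, weight, ← ENNReal.ofReal_mul (Real.exp_pos _).le,
      ← ENNReal.ofReal_mul (by positivity)]
    refine ENNReal.ofReal_le_ofReal ?_
    have h1 := hprof (H x) (H (ψ x)) (h.nonneg _) (h.nonneg _)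
    have h2 : K * |H x - H (ψ x)| ≤ K * (8 * M ^ 2) * R * r ^ 2 := by
      rw [abs_sub_comm]
      have := mul_le_mul_of_nonneg_left
        (h.abs_apply_add_smul_truncField_sub_le hR0 r x) hK.le
      linarith
    have h3 := one_sub_le_abs_det (truncFieldDeriv H R x) (r := r) (hL R hR0 x)
      (h.trace_truncFieldDeriv R x)
    have h4 : 1 ≤ Real.exp (4 * (r * L) ^ 2) * |(D x).det| := by
      have h5 := Real.add_one_le_exp (4 * (r * L) ^ 2)
      have h6 : 0 ≤ (r * L) ^ 2 := sq_nonneg _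
      -- For q = (rL)² ≥ 0 the inequality (1 + 4q)(1 - 2q) ≥ 1 holds when q ≤ 1/4.
      calc 1 ≤ (4 * (r * L) ^ 2 + 1) * (1 - 2 * (r * L) ^ 2) := by nlinarith
        _ ≤ _ := mul_le_mul h5 h3 (by linarith) (Real.exp_pos _).le
    have h7 : 4 * (r * L) ^ 2 ≤ 4 * L ^ 2 * R * r ^ 2 := by
      have : 0 ≤ 4 * L ^ 2 * r ^ 2 := by positivity
      nlinarith
    calc profile lam (H x) ≤ Real.exp (K * |H x - H (ψ x)|) * profile lam (H (ψ x)) := h1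
      _ ≤ Real.exp (K * (8 * M ^ 2) * R * r ^ 2) * profile lam (H (ψ x)) := by
          have := (profile_pos lam (H (ψ x))).le
          gcongr
      _ ≤ Real.exp (K * (8 * M ^ 2) * R * r ^ 2) * profile lam (H (ψ x)) *
            (Real.exp (4 * (r * L) ^ 2) * |(D x).det|) :=
          le_mul_of_one_le_right (mul_nonneg (Real.exp_pos _).le (profile_pos _ _).le) h4
      _ ≤ Real.exp (K * (8 * M ^ 2) * R * r ^ 2) * profile lam (H (ψ x)) *
            (Real.exp (4 * L ^ 2 * R * r ^ 2) * |(D x).det|) := by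
          have := (profile_pos lam (H (ψ x))).le
          gcongr
      _ = _ := by rw [add_mul, add_mul, Real.exp_add]; ring
  calc ∫⁻ x, weight H lam x * g (ψ x)
      ≤ ∫⁻ x, ENNReal.ofReal (Real.exp ((K * (8 * M ^ 2) + 4 * L ^ 2) * R * r ^ 2)) *
        (ENNReal.ofReal |(D x).det| * (weight H lam (ψ x) * g (ψ x))) := lintegral_mono hpt
    _ = ENNReal.ofReal (Real.exp ((K * (8 * M ^ 2) + 4 * L ^ 2) * R * r ^ 2)) *
        ∫⁻ x in ψ '' univ, weight H lam x * g x := by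
        rw [lintegral_const_mul' _ _ ENNReal.ofReal_ne_top,
          lintegral_image_eq_lintegral_abs_det_fderiv_mul volume MeasurableSet.univ hder hinj,
          setLIntegral_univ]
    -- An upper bound does not need surjectivity of the step map: the image is simply enlarged to
    -- the whole plane.
    _ ≤ _ := by gcongr; exact Measure.restrict_le_self

end Step

/-! ### The splitting scheme and its convergence along a fixed path -/

section Scheme

/-- The explicit scheme with drift `b`, steps `δ` and increments `d`, started at `x`. -/
def scheme (b : Plane → Plane) (δ : ℕ → ℝ≥0) (d : ℕ → Plane) (x : Plane) : ℕ → Plane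
  | 0 => x
  | k + 1 => scheme b δ d x k + (δ k : ℝ) • b (scheme b δ d x k) + d k

/-- The partition points determined by the steps `δ`. -/
def partTime (δ : ℕ → ℝ≥0) (k : ℕ) : ℝ≥0 := ∑ i ∈ Finset.range k, δ i

theorem partTime_zero (δ : ℕ → ℝ≥0) : partTime δ 0 = 0 := by simp [partTime]

theorem partTime_succ (δ : ℕ → ℝ≥0) (k : ℕ) : partTime δ (k + 1) = partTime δ k + δ k := by
  simp [partTime, Finset.sum_range_succ]

theorem monotone_partTime (δ : ℕ → ℝ≥0) : Monotone (partTime δ) :=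
  monotone_nat_of_le_succ fun k => by rw [partTime_succ]; exact le_self_add

variable {b B : Plane → Plane} {δ : ℕ → ℝ≥0}

theorem measurable_scheme (hb : Measurable b) (δ : ℕ → ℝ≥0) (k : ℕ) :
    Measurable fun p : Plane × (ℕ → Plane) => scheme b δ p.2 p.1 k := by
  induction k with
  | zero => exact measurable_fst
  | succ k ih =>
    have h1 : Measurable fun p : Plane × (ℕ → Plane) => p.2 k :=
      (measurable_pi_apply k).comp measurable_snd
    have h2 : Measurable fun p : Plane × (ℕ → Plane) =>
        (δ k : ℝ) • b (scheme b δ p.2 p.1 k) := (hb.comp ih).const_smul (δ k : ℝ)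
    exact (ih.add h2).add h1

theorem scheme_congr {d d' : ℕ → Plane} (x : Plane) {k : ℕ} (h : ∀ i < k, d i = d' i) :
    scheme b δ d x k = scheme b δ d' x k := by
  induction k with
  | zero => rfl
  | succ k ih =>
    rw [scheme, scheme, ih fun i hi => h i (hi.trans k.lt_succ_self), h k k.lt_succ_self]

theorem norm_add_smul_sub_le {L : ℝ} (hb : ∀ x y, ‖b x - b y‖ ≤ L * ‖x - y‖) (r : ℝ≥0)
    (x y : Plane) : ‖(x + (r : ℝ) • b x) - (y + (r : ℝ) • b y)‖ ≤ Real.exp (L * r) * ‖x - y‖ := by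
  calc ‖(x + (r : ℝ) • b x) - (y + (r : ℝ) • b y)‖ = ‖(x - y) + (r : ℝ) • (b x - b y)‖ := by
        rw [smul_sub]; congr 1; abel
    _ ≤ ‖x - y‖ + r * (L * ‖x - y‖) := by
        refine (norm_add_le _ _).trans (add_le_add le_rfl ?_)
        rw [norm_smul, Real.norm_of_nonneg r.coe_nonneg]
        exact mul_le_mul_of_nonneg_left (hb x y) r.coe_nonneg
    _ = (L * r + 1) * ‖x - y‖ := by ring
    _ ≤ _ := mul_le_mul_of_nonneg_right (Real.add_one_le_exp _) (norm_nonneg _)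

/-- Two runs with the same noise differ only through the drift. The constant depends on the elapsed
time and not on the partition, which gives equicontinuity in the mesh later. -/
theorem norm_scheme_sub_le {L : ℝ} (hb : ∀ x y, ‖b x - b y‖ ≤ L * ‖x - y‖) (d : ℕ → Plane)
    (x y : Plane) (k : ℕ) :
    ‖scheme b δ d x k - scheme b δ d y k‖ ≤ Real.exp (L * partTime δ k) * ‖x - y‖ := by
  induction k with
  | zero => simp [scheme, partTime_zero]
  | succ k ih =>
    rw [scheme, scheme, add_sub_add_right_eq_sub, partTime_succ]
    refine (norm_add_smul_sub_le hb (δ k) _ _).trans ?_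
    refine (mul_le_mul_of_nonneg_left ih (Real.exp_pos _).le).trans (le_of_eq ?_)
    rw [← mul_assoc, ← Real.exp_add]
    push_cast
    ring_nf

/-- Discrete Gronwall argument. The two drifts need to agree only along the solution X, not along
the scheme, because b is Lipschitz everywhere. -/
theorem norm_scheme_sub_solution_le {L T ρ η : ℝ} (hL : 0 ≤ L)
    (hB : ∀ x y, ‖B x - B y‖ ≤ L * ‖x - y‖) (hb : ∀ x y, ‖b x - b y‖ ≤ L * ‖x - y‖)
    {w X : ℝ≥0 → Plane} {x : Plane} (hX : Continuous X)
    (hsol : ∀ t : ℝ≥0, X t = x + (∫ s in (0 : ℝ)..t, B (X s.toNNReal)) + w t) (h0 : X 0 = x)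
    (hmod : ∀ s t : ℝ≥0, s ≤ T → t ≤ T → dist s t ≤ ρ → ‖X s - X t‖ ≤ η) (hη : 0 ≤ η)
    (hbB : ∀ t : ℝ≥0, t ≤ T → b (X t) = B (X t)) {N : ℕ} (hN : partTime δ N ≤ T)
    (hδ : ∀ i < N, δ i ≤ ρ) {k : ℕ} (hk : k ≤ N) :
    ‖scheme b δ (fun i => w (partTime δ (i + 1)) - w (partTime δ i)) x k - X (partTime δ k)‖ ≤
      partTime δ k * (L * η) * Real.exp (L * partTime δ k) := by
  have hBc : Continuous B := (LipschitzWith.of_dist_le_mul (K := L.toNNReal) fun x y => by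
    rw [dist_eq_norm, dist_eq_norm, Real.coe_toNNReal _ hL]; exact hB x y).continuous
  have hint : ∀ a c : ℝ, IntervalIntegrable (fun s => B (X s.toNNReal)) volume a c := fun a c =>
    (hBc.comp (hX.comp continuous_real_toNNReal)).intervalIntegrable a c
  induction k with
  | zero => simp [scheme, partTime_zero, h0]
  | succ k ih =>
    have ih := ih (Nat.le_of_succ_le hk)
    have hkT : ((partTime δ (k + 1) : ℝ≥0) : ℝ) ≤ T :=
      le_trans (by exact_mod_cast monotone_partTime δ hk) hN
    set t := partTime δ k with ht
    set Z := scheme b δ (fun i => w (partTime δ (i + 1)) - w (partTime δ i)) x k with hZ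
    have htT : (t : ℝ) ≤ T := le_trans (by exact_mod_cast monotone_partTime δ k.le_succ) hkT
    have ht' : partTime δ (k + 1) = t + δ k := partTime_succ δ k
    -- The noise increment here is the one used by the scheme, so it cancels exactly and no
    -- regularity of w is required.
    have hXinc : X (t + δ k) = X t + (∫ s in (t : ℝ)..(t + δ k : ℝ≥0), B (X s.toNNReal)) +
        (w (t + δ k) - w t) := by
      rw [hsol (t + δ k), hsol t, ← intervalIntegral.integral_add_adjacent_intervals
        (hint 0 t) (hint t (t + δ k : ℝ≥0))]
      abel
    have herr : ‖(∫ s in (t : ℝ)..(t + δ k : ℝ≥0), B (X s.toNNReal)) - (δ k : ℝ) • b (X t)‖ ≤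
        L * η * δ k := by
      have e : (δ k : ℝ) • b (X t) = ∫ _ in (t : ℝ)..(t + δ k : ℝ≥0), B (X t) := by
        rw [intervalIntegral.integral_const, hbB t htT]; simp
      rw [e, ← intervalIntegral.integral_sub (hint _ _) (by simp)]
      have := intervalIntegral.norm_integral_le_of_norm_le_const (a := (t : ℝ))
        (b := (t + δ k : ℝ≥0)) (f := fun s => B (X s.toNNReal) - B (X t)) (C := L * η)
        (fun s hs => by
          rw [uIoc_of_le (by simp)] at hs
          have hs0 : 0 ≤ s := t.coe_nonneg.trans hs.1.le
          have hs2 : s ≤ t + δ k := by simpa using hs.2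
          refine (hB _ _).trans (mul_le_mul_of_nonneg_left (hmod _ _ ?_ htT ?_) hL)
          · rw [Real.coe_toNNReal _ hs0]
            refine hs2.trans ?_
            rw [ht'] at hkT
            simpa using hkT
          · rw [NNReal.dist_eq, Real.coe_toNNReal _ hs0, abs_of_nonneg (by linarith [hs.1])]
            linarith [hδ k hk])
      simpa using this
    rw [scheme, ← hZ, ht']
    have hE : 1 ≤ Real.exp (L * (t + δ k : ℝ≥0)) := Real.one_le_exp (by positivity)
    calc ‖Z + (δ k : ℝ) • b Z + (w (t + δ k) - w t) - X (t + δ k)‖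
        = ‖((Z + (δ k : ℝ) • b Z) - (X t + (δ k : ℝ) • b (X t))) -
            ((∫ s in (t : ℝ)..(t + δ k : ℝ≥0), B (X s.toNNReal)) - (δ k : ℝ) • b (X t))‖ := by
          rw [hXinc]; congr 1; abel
      _ ≤ Real.exp (L * δ k) * ‖Z - X t‖ + L * η * δ k :=
          (norm_sub_le _ _).trans (add_le_add (norm_add_smul_sub_le hb _ _ _) herr)
      _ ≤ Real.exp (L * δ k) * (t * (L * η) * Real.exp (L * t)) +
            L * η * δ k * Real.exp (L * (t + δ k : ℝ≥0)) := by
          refine add_le_add (mul_le_mul_of_nonneg_left ih (Real.exp_pos _).le) ?_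
          exact le_mul_of_one_le_right (by positivity) hE
      _ = ((t + δ k : ℝ≥0) : ℝ) * (L * η) * Real.exp (L * (t + δ k : ℝ≥0)) := by
          push_cast
          rw [mul_add L, Real.exp_add]
          ring

theorem tendsto_scheme {H : Plane → ℝ} (hH : Continuous H) {L : ℝ} (hL : 0 ≤ L)
    (hB : ∀ x y, ‖B x - B y‖ ≤ L * ‖x - y‖) {b : ℕ → Plane → Plane}
    (hb : ∀ n x y, ‖b n x - b n y‖ ≤ L * ‖x - y‖) {R : ℕ → ℝ} (hR : Tendsto R atTop atTop)
    (hbB : ∀ n x, H x ≤ R n → b n x = B x) {δ : ℕ → ℕ → ℝ≥0} {N : ℕ → ℕ} {T : ℝ≥0}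
    (hT : ∀ᶠ n in atTop, partTime (δ n) (N n) = T) {ρ : ℕ → ℝ} (hρ : Tendsto ρ atTop (𝓝 0))
    (hδ : ∀ n, ∀ i < N n, δ n i ≤ ρ n)
    {w X : ℝ≥0 → Plane} {x : Plane} (hX : Continuous X)
    (hsol : ∀ t : ℝ≥0, X t = x + (∫ s in (0 : ℝ)..t, B (X s.toNNReal)) + w t) (h0 : X 0 = x) :
    Tendsto (fun n => scheme (b n) (δ n)
      (fun i => w (partTime (δ n) (i + 1)) - w (partTime (δ n) i)) x (N n)) atTop (𝓝 (X T)) := by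
  rw [Metric.tendsto_atTop']
  intro e he
  obtain ⟨η, hη0, hη⟩ : ∃ η > 0, T * (L * η) * Real.exp (L * T) < e := by
    have hc : 0 ≤ T * L * Real.exp (L * T) := by positivity
    refine ⟨e / (T * L * Real.exp (L * T) + 1), by positivity, ?_⟩
    rw [show (T : ℝ) * (L * (e / (T * L * Real.exp (L * T) + 1))) * Real.exp (L * T) =
      (T * L * Real.exp (L * T)) * e / (T * L * Real.exp (L * T) + 1) by ring,
      div_lt_iff₀ (by positivity)]
    linarith
  have hcomp : IsCompact (Icc (0 : ℝ≥0) T) := isCompact_Icc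
  obtain ⟨r, hr0, hr⟩ := Metric.uniformContinuousOn_iff_le.1
    (hcomp.uniformContinuousOn_of_continuous hX.continuousOn) η hη0
  -- H is bounded on the compact path, so the truncation is eventually invisible along it.
  obtain ⟨S, hS⟩ := hcomp.exists_bound_of_continuousOn (hH.comp hX).continuousOn
  have hev : ∀ᶠ n in atTop, ρ n ≤ r ∧ S ≤ R n ∧ partTime (δ n) (N n) = T :=
    (hρ.eventually (ge_mem_nhds hr0)).and ((hR.eventually_ge_atTop S).and hT)
  obtain ⟨n₀, hn₀⟩ := eventually_atTop.1 hev
  refine ⟨n₀, fun n hn => ?_⟩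
  obtain ⟨h1, h2, h3⟩ := hn₀ n hn.le
  have := norm_scheme_sub_solution_le (δ := δ n) (T := T) (ρ := r) (η := η) hL hB (hb n) hX hsol h0
    (fun s t hs ht hst => by
      rw [← dist_eq_norm]
      exact hr s ⟨zero_le, by exact_mod_cast hs⟩ t ⟨zero_le, by exact_mod_cast ht⟩ hst)
    hη0.le (fun t ht => hbB n _ (((le_abs_self _).trans
      (hS t ⟨zero_le, by exact_mod_cast ht⟩)).trans h2))
    (by rw [h3]) (fun i hi => (hδ n i hi).trans h1) le_rfl
  rw [h3] at this
  rw [dist_eq_norm]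
  exact this.trans_lt hη

end Scheme

/-! ### The scheme driven by Brownian increments -/

section Noise

/-- The variables `d k` are independent with centered Gaussian laws of variance `δ k`. -/
structure IsGaussianNoise (δ : ℕ → ℝ≥0) (d : ℕ → Ω → Plane) (P : Measure Ω) : Prop where
  measurable : ∀ k, Measurable (d k)
  law : ∀ k, P.map (d k) = gaussPlane (δ k)
  indep : ∀ k, IndepFun (fun ω (i : Finset.range k) => d i ω) (d k) P

/-- Independent coordinates with independent increments make the whole array over (coordinate, step)
independent; grouping it by steps gives the noise. -/
theorem IsPlanarBrownian.exists_isGaussianNoise {P : Measure Ω} [IsProbabilityMeasure P]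
    {w : ℝ≥0 → Ω → Plane} (hw : IsPlanarBrownian w P) (δ : ℕ → ℝ≥0) :
    ∃ d : ℕ → Ω → Plane, IsGaussianNoise δ d P ∧
      ∀ᵐ ω ∂P, ∀ k, d k ω = w (partTime δ (k + 1)) ω - w (partTime δ k) ω := by
  set t := partTime δ with ht
  set D : Fin 2 → ℕ → Ω → ℝ := fun i k ω => w (t (k + 1)) ω i - w (t k) ω i with hD
  have hDm : ∀ i k, AEMeasurable (D i k) P := fun i k =>
    ((hw.coord i).aemeasurable _).sub ((hw.coord i).aemeasurable _)
  -- Increments are only almost everywhere measurable; genuine measurability is needed for joint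
  -- measurability of the scheme in (x, ω).
  set D' : Fin 2 → ℕ → Ω → ℝ := fun i k => (hDm i k).mk (D i k) with hD'
  have hD'm : ∀ i k, Measurable (D' i k) := fun i k => (hDm i k).measurable_mk
  have hDD' : ∀ i k, D i k =ᵐ[P] D' i k := fun i k => (hDm i k).ae_eq_mk
  have hD'law : ∀ i k, P.map (D' i k) = gaussianReal 0 (δ k) := fun i k => by
    rw [← Measure.map_congr (hDD' i k)]
    have := ((hw.coord i).hasLaw_sub (t (k + 1)) (t k)).map_eq
    have e : nndist (t (k + 1)).1 (t k).1 = δ k := by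
      ext
      have : ((t (k + 1) : ℝ≥0) : ℝ) = t k + δ k := by rw [ht, partTime_succ]; push_cast; rfl
      rw [coe_nndist, Real.dist_eq]
      change |((t (k + 1) : ℝ≥0) : ℝ) - t k| = _
      rw [this, add_sub_cancel_left, NNReal.abs_eq]
    rw [e] at this
    exact this
  have h1 : iIndepFun (fun i ω k => D i k ω) P :=
    hw.indep.comp (fun _ p k => p (t (k + 1)) - p (t k)) (fun _ => by fun_prop)
  have h1' : iIndepFun (fun i ω k => D' i k ω) P := h1.congr fun i => by
    filter_upwards [ae_all_iff.2 (hDD' i)] with ω hω using funext hω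
  have h2' : ∀ i, iIndepFun (D' i) P := fun i =>
    ((hw.coord i).hasIndepIncrements.nat (monotone_partTime δ)).congr (hDD' i)
  have hind : iIndepFun (fun (p : Fin 2 × ℕ) ω => D' p.1 p.2 ω) P :=
    iIndepFun_uncurry' hD'm h1' h2'
  refine ⟨fun k ω => WithLp.toLp 2 fun i => D' i k ω, ⟨fun k => ?_, fun k => ?_, fun k => ?_⟩, ?_⟩
  · exact (WithLp.measurable_toLp 2 _).comp (measurable_pi_lambda _ fun i => hD'm i k)
  · have hk : iIndepFun (fun i => D' i k) P :=
      hind.precomp (g := fun i : Fin 2 => (i, k)) fun a b hab => by simpa using hab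
    have := (iIndepFun_iff_map_fun_eq_pi_map fun i => (hD'm i k).aemeasurable).1 hk
    simp only [hD'law] at this
    rw [← map_pi_gaussianReal_eq_gaussPlane, ← this,
      Measure.map_map (by fun_prop) (measurable_pi_lambda _ fun i => hD'm i k)]
    rfl
  · have hdisj : Disjoint ((Finset.univ : Finset (Fin 2)) ×ˢ Finset.range k)
        ((Finset.univ : Finset (Fin 2)) ×ˢ {k}) := by
      rw [Finset.disjoint_left]
      rintro ⟨i, j⟩ hj hj'
      simp only [Finset.mem_product, Finset.mem_univ, true_and, Finset.mem_range,
        Finset.mem_singleton] at hj hj'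
      omega
    have := hind.indepFun_finset _ _ hdisj fun p => hD'm p.1 p.2
    refine this.comp
      (φ := fun v (j : Finset.range k) => WithLp.toLp 2 fun i : Fin 2 =>
        v ⟨(i, j), by simp⟩)
      (ψ := fun v => WithLp.toLp 2 fun i : Fin 2 => v ⟨(i, k), by simp⟩) ?_ ?_
    · refine measurable_pi_lambda _ fun j => (WithLp.measurable_toLp 2 _).comp ?_
      exact measurable_pi_lambda _ fun i => measurable_pi_apply _
    · refine (WithLp.measurable_toLp 2 _).comp ?_
      exact measurable_pi_lambda _ fun i => measurable_pi_apply _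
  · filter_upwards [ae_all_iff.2 fun i => ae_all_iff.2 (hDD' i)] with ω hω k
    ext i
    simp [← hω i k, hD]

variable {P : Measure Ω} {b : Plane → Plane} {δ : ℕ → ℝ≥0}
  {d : ℕ → Ω → Plane}

namespace IsGaussianNoise

theorem measurable_scheme_prod (hd : IsGaussianNoise δ d P) (hb : Measurable b) (k : ℕ) :
    Measurable fun p : Plane × Ω => scheme b δ (fun i => d i p.2) p.1 k :=
  (measurable_scheme hb δ k).comp (measurable_fst.prodMk
    (measurable_pi_lambda _ fun i => (hd.measurable i).comp measurable_snd))

theorem measurable_scheme (hd : IsGaussianNoise δ d P) (hb : Measurable b) (x : Plane) (k : ℕ) :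
    Measurable fun ω => scheme b δ (fun i => d i ω) x k :=
  (hd.measurable_scheme_prod hb k).comp measurable_prodMk_left

variable [IsProbabilityMeasure P]

theorem map_scheme_prod (hd : IsGaussianNoise δ d P) (hb : Measurable b) (x : Plane) (k : ℕ) :
    P.map (fun ω => (scheme b δ (fun i => d i ω) x k, d k ω)) =
      (P.map fun ω => scheme b δ (fun i => d i ω) x k).prod (gaussPlane (δ k)) := by
  -- Extension by zero exhibits the k-th state as a measurable function of the increments before k,
  -- which are independent of the k-th one.
  set fill : (Finset.range k → Plane) → ℕ → Plane := fun v i =>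
    if h : i ∈ Finset.range k then v ⟨i, h⟩ else 0 with hfill
  have hfm : Measurable fill := measurable_pi_lambda _ fun i => by
    by_cases h : i ∈ Finset.range k
    · simp only [hfill, dif_pos h]
      exact measurable_pi_apply _
    · simp only [hfill, dif_neg h]
      exact measurable_const
  have e : (fun ω => scheme b δ (fun i => d i ω) x k) =
      (fun v => scheme b δ (fill v) x k) ∘ fun ω (i : Finset.range k) => d i ω := by
    funext ω
    exact scheme_congr x fun i hi => by simp [hfill, hi]
  have hφ : Measurable fun v => scheme b δ (fill v) x k :=
    (_root_.measurable_scheme hb δ k).comp (measurable_const.prodMk hfm)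
  have hind : IndepFun (fun ω => scheme b δ (fun i => d i ω) x k) (d k) P := by
    rw [e]
    exact (hd.indep k).comp hφ measurable_id
  rw [hind.map_prod_eq_prod_map_map (hd.measurable_scheme hb x k).aemeasurable
    (hd.measurable k).aemeasurable, hd.law]

theorem lintegral_scheme_succ (hd : IsGaussianNoise δ d P) (hb : Measurable b) (x : Plane) (k : ℕ)
    {g : Plane → ℝ≥0∞} (hg : Measurable g) :
    ∫⁻ ω, g (scheme b δ (fun i => d i ω) x (k + 1)) ∂P =
      ∫⁻ ω, (fun z => ∫⁻ y, g (z + (δ k : ℝ) • b z + y) ∂gaussPlane (δ k))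
        (scheme b δ (fun i => d i ω) x k) ∂P := by
  have hG : Measurable fun q : Plane × Plane => g (q.1 + (δ k : ℝ) • b q.1 + q.2) := by fun_prop
  have hZ := hd.measurable_scheme hb x k
  calc _ = ∫⁻ q, g (q.1 + (δ k : ℝ) • b q.1 + q.2)
        ∂P.map (fun ω => (scheme b δ (fun i => d i ω) x k, d k ω)) := by
        rw [lintegral_map hG (hZ.prodMk (hd.measurable k))]; rfl
    _ = _ := by
        rw [hd.map_scheme_prod hb, lintegral_prod _ hG.aemeasurable,
          lintegral_map hG.lintegral_prod_right' hZ]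

theorem integral_scheme_succ (hd : IsGaussianNoise δ d P) (hb : Measurable b) (x : Plane) (k : ℕ)
    {u : Plane → ℝ} (hu : Measurable u) {C : ℝ} (hC : ∀ z, |u z| ≤ C) :
    ∫ ω, u (scheme b δ (fun i => d i ω) x (k + 1)) ∂P =
      ∫ ω, (fun z => ∫ y, u (z + (δ k : ℝ) • b z + y) ∂gaussPlane (δ k))
        (scheme b δ (fun i => d i ω) x k) ∂P := by
  have hG : Measurable fun q : Plane × Plane => u (q.1 + (δ k : ℝ) • b q.1 + q.2) := by fun_prop
  have hZ := hd.measurable_scheme hb x k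
  have : IsProbabilityMeasure (P.map fun ω => scheme b δ (fun i => d i ω) x k) :=
    Measure.isProbabilityMeasure_map hZ.aemeasurable
  calc _ = ∫ q, u (q.1 + (δ k : ℝ) • b q.1 + q.2)
        ∂P.map (fun ω => (scheme b δ (fun i => d i ω) x k, d k ω)) := by
        rw [integral_map (hZ.prodMk (hd.measurable k)).aemeasurable hG.aestronglyMeasurable]; rfl
    _ = _ := by
        rw [hd.map_scheme_prod hb, integral_prod]
        · exact integral_map hZ.aemeasurable
            hG.stronglyMeasurable.integral_prod_right'.aestronglyMeasurable
        · exact Integrable.of_bound hG.aestronglyMeasurable C (Eventually.of_forall fun q => hC _)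

/-- If every step of the scheme is bounded on the weighted space, so is the whole scheme. -/
theorem lintegral_mul_lintegral_scheme_le (hd : IsGaussianNoise δ d P) (hb : Measurable b)
    {f : Plane → ℝ≥0∞} {C : ℕ → ℝ≥0∞}
    (hC : ∀ k, ∀ g : Plane → ℝ≥0∞, Measurable g →
      ∫⁻ x, f x * ∫⁻ y, g (x + (δ k : ℝ) • b x + y) ∂gaussPlane (δ k) ≤ C k * ∫⁻ x, f x * g x)
    (N : ℕ) {g : Plane → ℝ≥0∞} (hg : Measurable g) :
    ∫⁻ x, f x * ∫⁻ ω, g (scheme b δ (fun i => d i ω) x N) ∂P ≤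
      (∏ k ∈ Finset.range N, C k) * ∫⁻ x, f x * g x := by
  induction N generalizing g with
  | zero => simp [scheme]
  | succ k ih =>
    simp only [hd.lintegral_scheme_succ hb _ k hg]
    have hG : Measurable fun q : Plane × Plane => g (q.1 + (δ k : ℝ) • b q.1 + q.2) := by fun_prop
    refine (ih hG.lintegral_prod_right').trans ?_
    rw [Finset.prod_range_succ, mul_assoc]
    gcongr
    exact hC k g hg

/-- The Markov property of the scheme. -/
theorem integral_scheme_add (hd : IsGaussianNoise δ d P) (hb : Measurable b) (x : Plane) (n : ℕ)
    {d' : ℕ → Ω → Plane} (hd' : IsGaussianNoise (fun k => δ (n + k)) d' P) (m : ℕ)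
    {u : Plane → ℝ} (hu : Measurable u) {C : ℝ} (hC : ∀ z, |u z| ≤ C) :
    ∫ ω, u (scheme b δ (fun i => d i ω) x (n + m)) ∂P =
      ∫ ω, (fun z => ∫ ω', u (scheme b (fun k => δ (n + k)) (fun i => d' i ω') z m) ∂P)
        (scheme b δ (fun i => d i ω) x n) ∂P := by
  -- The last step is peeled off and absorbed into u. The second noise enters only through its laws,
  -- so its relation to the first is irrelevant.
  induction m generalizing u with
  | zero => simp [scheme]
  | succ m ih =>
    have hG : Measurable fun q : Plane × Plane =>
      u (q.1 + (δ (n + m) : ℝ) • b q.1 + q.2) := by fun_prop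
    rw [← add_assoc, hd.integral_scheme_succ hb x (n + m) hu hC,
      ih (u := fun z => ∫ y, u (z + (δ (n + m) : ℝ) • b z + y) ∂gaussPlane (δ (n + m)))
        hG.stronglyMeasurable.integral_prod_right'.measurable (fun z => ?_)]
    · simp only [hd'.integral_scheme_succ hb _ m hu hC]
    · have := norm_integral_le_of_norm_le_const (μ := gaussPlane (δ (n + m)))
        (f := fun y => u (z + (δ (n + m) : ℝ) • b z + y)) (C := C)
        (Eventually.of_forall fun y => hC _)
      simpa using this

end IsGaussianNoise

end Noise

/-! ### Averaged composition operators on `L²` -/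

section Averaging

theorem eLpNorm_two_sq {α : Type*} [MeasurableSpace α] (f : α → ℝ) (μ : Measure α) :
    eLpNorm f 2 μ ^ 2 = ∫⁻ x, ‖f x‖ₑ ^ 2 ∂μ := by
  have := eLpNorm_nnreal_pow_eq_lintegral (f := f) (μ := μ) (p := 2) two_ne_zero
  simpa using this

theorem enorm_integral_sq_le {P : Measure Ω} [IsProbabilityMeasure P] {f : Ω → ℝ}
    (hf : AEStronglyMeasurable f P) : ‖∫ ω, f ω ∂P‖ₑ ^ 2 ≤ ∫⁻ ω, ‖f ω‖ₑ ^ 2 ∂P := by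
  rw [← eLpNorm_two_sq]
  gcongr
  refine (enorm_integral_le_lintegral_enorm f).trans ?_
  rw [← eLpNorm_one_eq_lintegral_enorm]
  exact eLpNorm_le_eLpNorm_of_exponent_le (by norm_num) hf

variable {P : Measure Ω} {μ : Measure Plane} {Y : Plane × Ω → Plane} {C : ℝ≥0}

theorem memLp_comp_of_map_le (hY : Measurable Y) (hC : (μ.prod P).map Y ≤ C • μ) {u : Plane → ℝ}
    (hu : MemLp u 2 μ) : MemLp (fun p => u (Y p)) 2 (μ.prod P) := by
  have h1 : MemLp u 2 ((μ.prod P).map Y) :=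
    (hu.smul_measure (ENNReal.coe_ne_top (r := C))).mono_measure hC
  exact h1.comp_of_map hY.aemeasurable

/-- Domination implies absolute continuity, so null sets of μ are not charged by Y. This is the
independence of the representative. -/
theorem average_congr [SFinite P] (hY : Measurable Y) (hC : (μ.prod P).map Y ≤ C • μ) {u v : Plane → ℝ}
    (huv : u =ᵐ[μ] v) :
    (fun x => ∫ ω, u (Y (x, ω)) ∂P) =ᵐ[μ] fun x => ∫ ω, v (Y (x, ω)) ∂P := by
  have h1 : u =ᵐ[(μ.prod P).map Y] v :=
    (Measure.absolutelyContinuous_of_le_smul (c := C) hC).ae_eq huv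
  filter_upwards [Measure.ae_ae_of_ae_prod (ae_of_ae_map hY.aemeasurable h1)] with x hx
  exact integral_congr_ae hx

variable [IsProbabilityMeasure P]

/-- Jensen's inequality in ω, Tonelli, then domination of the law of Y; the square root comes from
comparing squared norms. -/
theorem eLpNorm_average_le (hY : Measurable Y) (hC : (μ.prod P).map Y ≤ C • μ) {u : Plane → ℝ}
    (hu : MemLp u 2 μ) :
    eLpNorm (fun x => ∫ ω, u (Y (x, ω)) ∂P) 2 μ ≤ (NNReal.sqrt C : ℝ≥0) * eLpNorm u 2 μ := by
  have hc := memLp_comp_of_map_le hY hC hu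
  have key : eLpNorm (fun x => ∫ ω, u (Y (x, ω)) ∂P) 2 μ ^ 2 ≤
      ((NNReal.sqrt C : ℝ≥0) * eLpNorm u 2 μ) ^ 2 := by
    calc eLpNorm (fun x => ∫ ω, u (Y (x, ω)) ∂P) 2 μ ^ 2
        = ∫⁻ x, ‖∫ ω, u (Y (x, ω)) ∂P‖ₑ ^ 2 ∂μ := eLpNorm_two_sq _ _
      _ ≤ ∫⁻ x, ∫⁻ ω, ‖u (Y (x, ω))‖ₑ ^ 2 ∂P ∂μ := by
          refine lintegral_mono_ae ?_
          filter_upwards [hc.aestronglyMeasurable.prodMk_left] with x hx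
          exact enorm_integral_sq_le hx
      _ = ∫⁻ p, ‖u (Y p)‖ₑ ^ 2 ∂μ.prod P :=
          (lintegral_prod _ (hc.aestronglyMeasurable.enorm.pow_const 2)).symm
      _ = ∫⁻ x, ‖u x‖ₑ ^ 2 ∂(μ.prod P).map Y := by
          have h1 : AEStronglyMeasurable u ((μ.prod P).map Y) :=
            ((hu.smul_measure (ENNReal.coe_ne_top (r := C))).mono_measure hC).aestronglyMeasurable
          rw [lintegral_map' (h1.enorm.pow_const 2) hY.aemeasurable]
      _ ≤ ∫⁻ x, ‖u x‖ₑ ^ 2 ∂(C • μ) := lintegral_mono' hC le_rfl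
      _ = C * eLpNorm u 2 μ ^ 2 := by
          rw [eLpNorm_two_sq, lintegral_smul_measure]; rfl
      _ = _ := by
          rw [mul_pow, ← ENNReal.coe_pow, NNReal.sq_sqrt]
  exact (ENNReal.pow_le_pow_left_iff two_ne_zero).1 key

variable [IsFiniteMeasure μ]

theorem ae_integrable_of_map_le (hY : Measurable Y) (hC : (μ.prod P).map Y ≤ C • μ)
    {u : Plane → ℝ} (hu : MemLp u 2 μ) : ∀ᵐ x ∂μ, Integrable (fun ω => u (Y (x, ω))) P :=
  ((memLp_comp_of_map_le hY hC hu).integrable one_le_two).prod_right_ae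

theorem memLp_average (hY : Measurable Y) (hC : (μ.prod P).map Y ≤ C • μ) {u : Plane → ℝ}
    (hu : MemLp u 2 μ) : MemLp (fun x => ∫ ω, u (Y (x, ω)) ∂P) 2 μ :=
  ⟨(memLp_comp_of_map_le hY hC hu).aestronglyMeasurable.integral_prod_right',
    (eLpNorm_average_le hY hC hu).trans_lt (ENNReal.mul_lt_top ENNReal.coe_lt_top hu.2)⟩

/-- If the law of `Y` under `μ ⊗ P` is dominated by `C μ`, then averaging of `u ∘ Y` over `P` is a
bounded operator on `L²(μ)` of norm at most `√C`. -/
theorem exists_average_operator (hY : Measurable Y) (hC : (μ.prod P).map Y ≤ C • μ) :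
    ∃ S : Lp ℝ 2 μ →L[ℝ] Lp ℝ 2 μ, ‖S‖ ≤ √(C : ℝ) ∧ ∀ (u : Plane → ℝ) (hu : MemLp u 2 μ),
      S (hu.toLp u) =ᵐ[μ] fun x => ∫ ω, u (Y (x, ω)) ∂P := by
  set S₀ : Lp ℝ 2 μ → Lp ℝ 2 μ := fun u => (memLp_average hY hC (Lp.memLp u)).toLp _ with hS₀
  have hS₀' : ∀ u : Lp ℝ 2 μ, S₀ u =ᵐ[μ] fun x => ∫ ω, u (Y (x, ω)) ∂P := fun u =>
    MemLp.coeFn_toLp _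
  have hadd : ∀ u v, S₀ (u + v) = S₀ u + S₀ v := fun u v => by
    refine Lp.ext ?_
    filter_upwards [hS₀' (u + v), hS₀' u, hS₀' v, Lp.coeFn_add (S₀ u) (S₀ v),
      average_congr hY hC (Lp.coeFn_add u v), ae_integrable_of_map_le hY hC (Lp.memLp u),
      ae_integrable_of_map_le hY hC (Lp.memLp v)] with x h1 h2 h3 h4 h5 h6 h7
    rw [h1, h5, h4, Pi.add_apply, h2, h3, ← integral_add h6 h7]
    rfl
  have hsmul : ∀ (c : ℝ) u, S₀ (c • u) = c • S₀ u := fun c u => by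
    refine Lp.ext ?_
    filter_upwards [hS₀' (c • u), hS₀' u, Lp.coeFn_smul c (S₀ u),
      average_congr hY hC (Lp.coeFn_smul c u)] with x h1 h2 h3 h4
    rw [h1, h4, h3, Pi.smul_apply, h2, ← integral_smul]
    rfl
  have hbound : ∀ u, ‖S₀ u‖ ≤ √(C : ℝ) * ‖u‖ := fun u => by
    rw [hS₀, Lp.norm_toLp, Lp.norm_def, ← Real.coe_sqrt, ← ENNReal.coe_toReal,
      ← ENNReal.toReal_mul]
    exact ENNReal.toReal_mono (ENNReal.mul_ne_top ENNReal.coe_ne_top (Lp.eLpNorm_ne_top u))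
      (eLpNorm_average_le hY hC (Lp.memLp u))
  refine ⟨LinearMap.mkContinuous ⟨⟨S₀, hadd⟩, hsmul⟩ _ hbound,
    LinearMap.mkContinuous_norm_le _ (Real.sqrt_nonneg _) _, fun u hu => ?_⟩
  exact (hS₀' (hu.toLp u)).trans (average_congr hY hC hu.coeFn_toLp)

/-- A limit of maps with dominated laws has a dominated law. -/
theorem map_le_of_tendsto (hC0 : C ≠ 0) {Z : ℕ → Plane × Ω → Plane} (hZ : ∀ n, Measurable (Z n))
    (hY : Measurable Y) (hlim : ∀ᵐ p ∂μ.prod P, Tendsto (fun n => Z n p) atTop (𝓝 (Y p)))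
    {c : ℕ → ℝ≥0∞} (hc : Tendsto c atTop (𝓝 C))
    (hle : ∀ᶠ n in atTop, ∀ g : Plane → ℝ≥0∞, Measurable g →
      ∫⁻ p, g (Z n p) ∂μ.prod P ≤ c n * ∫⁻ x, g x ∂μ) : (μ.prod P).map Y ≤ C • μ := by
  -- Indicators of open sets are lower semicontinuous, so Fatou's lemma applies without any
  -- continuity of the limit law.
  have hopen : ∀ U : Set Plane, IsOpen U → (μ.prod P).map Y U ≤ C * μ U := fun U hU => by
    set g : Plane → ℝ≥0∞ := U.indicator 1 with hg
    have hgm : Measurable g := measurable_one.indicator hU.measurableSet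
    have hgi : ∫⁻ x, g x ∂μ = μ U := lintegral_indicator_one hU.measurableSet
    calc (μ.prod P).map Y U = ∫⁻ p, g (Y p) ∂μ.prod P := by
          rw [← lintegral_map hgm hY, hg, lintegral_indicator_one hU.measurableSet]
      _ ≤ ∫⁻ p, liminf (fun n => g (Z n p)) atTop ∂μ.prod P := by
          refine lintegral_mono_ae ?_
          filter_upwards [hlim] with p hp
          by_cases hpU : Y p ∈ U
          · refine le_liminf_of_le (by isBoundedDefault) ?_
            filter_upwards [hp.eventually (hU.mem_nhds hpU)] with n hn
            have hn : Z n p ∈ U := hn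
            simp [hg, hpU, hn]
          · simp [hg, hpU]
      _ ≤ liminf (fun n => ∫⁻ p, g (Z n p) ∂μ.prod P) atTop :=
          lintegral_liminf_le fun n => hgm.comp (hZ n)
      _ ≤ liminf (fun n => c n * μ U) atTop := by
          refine liminf_le_liminf ?_
          filter_upwards [hle] with n hn
          exact (hn g hgm).trans_eq (by rw [hgi])
      _ = C * μ U :=
          (ENNReal.Tendsto.mul_const hc (Or.inr (measure_ne_top μ U))).liminf_eq
  -- Outer regularity of μ extends the estimate from open sets to all measurable sets.
  refine Measure.le_iff.2 fun A _ => ?_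
  rw [Measure.smul_apply, ENNReal.smul_def, smul_eq_mul, A.measure_eq_iInf_isOpen μ]
  have hC0' : (C : ℝ≥0∞) ≠ 0 := by exact_mod_cast hC0
  simp only [ENNReal.mul_iInf_of_ne hC0' ENNReal.coe_ne_top]
  exact le_iInf fun U => le_iInf fun hAU => le_iInf fun hU => (measure_mono hAU).trans (hopen U hU)

end Averaging

/-! ### The transition operators of the diffusion -/

section Diffusion

/-- The truncated drift of the `n`-th approximation. -/
def approxDrift (H : Plane → ℝ) (ε : ℝ) (n : ℕ) (x : Plane) : Plane :=
  ε⁻¹ • truncField H √(n + 1) x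

/-- `n + 1` equal steps on `[0, t]`, continued indefinitely. -/
def unifStep (t : ℝ≥0) (n : ℕ) : ℕ → ℝ≥0 := fun _ => t / (n + 1 : ℕ)

/-- `n + 1` equal steps on `[0, s]`, followed by the steps of `unifStep t n`. -/
def blockStep (s t : ℝ≥0) (n : ℕ) : ℕ → ℝ≥0 := fun k =>
  if k < n + 1 then s / (n + 1 : ℕ) else t / (n + 1 : ℕ)

theorem partTime_unifStep (t : ℝ≥0) (n : ℕ) : partTime (unifStep t n) (n + 1) = t := by
  rw [partTime]
  simp only [unifStep, Finset.sum_const, Finset.card_range, nsmul_eq_mul]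
  exact mul_div_cancel₀ t (by positivity)

theorem blockStep_add (s t : ℝ≥0) (n : ℕ) :
    (fun k => blockStep s t n (n + 1 + k)) = unifStep t n := by
  funext k
  rw [blockStep, if_neg (by omega), unifStep]

theorem partTime_blockStep (s t : ℝ≥0) (n : ℕ) : partTime (blockStep s t n) (n + 1) = s := by
  rw [← partTime_unifStep s n, partTime, partTime]
  exact Finset.sum_congr rfl fun k hk => by simp [blockStep, unifStep, Finset.mem_range.1 hk]

theorem partTime_blockStep_add (s t : ℝ≥0) (n : ℕ) :
    partTime (blockStep s t n) (n + 1 + (n + 1)) = s + t := by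
  have h1 := partTime_blockStep s t n
  have h2 := partTime_unifStep t n
  rw [← blockStep_add s t n] at h2
  rw [partTime] at *
  rw [Finset.sum_range_add, h1]
  exact congrArg (s + ·) h2

theorem blockStep_le (s t : ℝ≥0) (n k : ℕ) : blockStep s t n k ≤ (s + t) / (n + 1 : ℕ) := by
  rw [blockStep]
  split_ifs
  · gcongr; exact le_self_add
  · gcongr; exact le_add_self

theorem tendsto_div_succ (a : ℝ) : Tendsto (fun n : ℕ => a / (n + 1 : ℕ)) atTop (𝓝 0) :=
  (tendsto_const_div_atTop_nhds_zero_nat a).comp (tendsto_add_atTop_nat 1)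

theorem tendsto_radius : Tendsto (fun n : ℕ => √((n : ℝ) + 1)) atTop atTop :=
  Real.tendsto_sqrt_atTop.comp
    (tendsto_natCast_atTop_atTop.atTop_add tendsto_const_nhds)

theorem one_le_radius (n : ℕ) : 1 ≤ √((n : ℝ) + 1) := Real.one_le_sqrt.2 (by simp)

variable {H : Plane → ℝ} {M : ℝ}

theorem IsTameHamiltonian.continuous_approxDrift (h : IsTameHamiltonian H M) (ε : ℝ) (n : ℕ) :
    Continuous (approxDrift H ε n) := by
  have : Continuous (truncField H √((n : ℝ) + 1)) :=
    continuous_iff_continuousAt.2 fun x => (h.hasFDerivAt_truncField _ x).continuousAt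
  exact this.const_smul ε⁻¹

theorem IsTameHamiltonian.exists_lipschitz_approxDrift (h : IsTameHamiltonian H M) {ε : ℝ}
    (hε : 0 < ε) : ∃ L : ℝ, 0 ≤ L ∧
      (∀ x y, ‖ε⁻¹ • skewGradient H x - ε⁻¹ • skewGradient H y‖ ≤ L * ‖x - y‖) ∧
      ∀ n x y, ‖approxDrift H ε n x - approxDrift H ε n y‖ ≤ L * ‖x - y‖ := by
  obtain ⟨L, hL0, hL⟩ := h.exists_lipschitz_truncField
  refine ⟨ε⁻¹ * max M L, by positivity, fun x y => ?_, fun n x y => ?_⟩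
  · rw [← smul_sub, norm_smul, Real.norm_of_nonneg (by positivity), mul_assoc]
    gcongr
    exact (h.norm_skewGradient_sub_le x y).trans (by gcongr; exact le_max_left _ _)
  · rw [approxDrift, approxDrift, ← smul_sub, norm_smul, Real.norm_of_nonneg (by positivity),
      mul_assoc]
    gcongr
    exact (h.norm_truncField_sub_le (hL _ (by have := one_le_radius n; linarith)) x y).trans
      (by gcongr; exact le_max_right _ _)

variable {P : Measure Ω} {ε : ℝ} {w : ℝ≥0 → Ω → Plane}
  {X : ℝ≥0 → Ω → Plane} {x : Plane}

theorem IsPlanarBrownian.ae_eval_zero (hw : IsPlanarBrownian w P) : ∀ᵐ ω ∂P, w 0 ω = 0 := by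
  filter_upwards [(hw.coord 0).eval_zero_ae_eq_zero, (hw.coord 1).eval_zero_ae_eq_zero] with ω h0 h1
  ext i
  fin_cases i
  · simpa using h0
  · simpa using h1

theorem SolvesSDE.ae_eval_zero (hX : SolvesSDE H ε w P x X) (hw : IsPlanarBrownian w P) :
    ∀ᵐ ω ∂P, X 0 ω = x := by
  filter_upwards [hX, hw.ae_eval_zero] with ω hω hw0
  simpa [hw0] using hω.2 0

/-- The scheme converges almost surely to the solution of the stochastic equation. -/
theorem SolvesSDE.ae_tendsto_scheme (h : IsTameHamiltonian H M) (hε : 0 < ε)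
    (hX : SolvesSDE H ε w P x X) (hw : IsPlanarBrownian w P) {δ : ℕ → ℕ → ℝ≥0} {N : ℕ → ℕ}
    {T : ℝ≥0} (hT : ∀ n, partTime (δ n) (N n) = T) {a : ℝ}
    (hδ : ∀ n k, (δ n k : ℝ) ≤ a / (n + 1 : ℕ)) {d : ℕ → ℕ → Ω → Plane}
    (hd : ∀ n, ∀ᵐ ω ∂P, ∀ k, d n k ω = w (partTime (δ n) (k + 1)) ω - w (partTime (δ n) k) ω) :
    ∀ᵐ ω ∂P, Tendsto (fun n => scheme (approxDrift H ε n) (δ n) (fun i => d n i ω) x (N n)) atTop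
      (𝓝 (X T ω)) := by
  obtain ⟨L, hL0, hL1, hL2⟩ := h.exists_lipschitz_approxDrift hε
  filter_upwards [hX, hX.ae_eval_zero hw, ae_all_iff.2 hd] with ω hω h0 hdω
  have := tendsto_scheme h.continuous hL0 hL1 hL2 tendsto_radius
    (fun n y hy => by
      rw [approxDrift, truncField_eq_skewGradient (by have := one_le_radius n; linarith) hy])
    (Eventually.of_forall hT) (tendsto_div_succ a) (fun n k _ => hδ n k)
    (w := fun t => w t ω) (X := fun t => X t ω) (x := x) hω.1
    (fun t => by rw [intervalIntegral.integral_smul]; exact hω.2 t) h0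
  simpa only [hdω] using this

variable [IsProbabilityMeasure P]

/-- The solutions for all starting points have a jointly measurable version whose law, started
from the weighted measure, is dominated by the weighted measure. -/
theorem exists_measurable_version (h : IsTameHamiltonian H M) {lam : ℝ} {κ r₀ c : ℝ}
    (hr₀ : 0 < r₀) (hε : 0 < ε)
    (hdrift : ∀ R ≥ (1 : ℝ), ∀ r : ℝ, |r| ≤ r₀ →
      ∀ g : Plane → ℝ≥0∞, ∫⁻ x, weight H lam x * g (x + r • truncField H R x) ≤
        ENNReal.ofReal (Real.exp (κ * R * r ^ 2)) * ∫⁻ x, weight H lam x * g x)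
    (hgauss : ∀ δ : ℝ≥0, δ ≤ 1 → ∀ x, ∫⁻ y, weight H lam (x - y) ∂gaussPlane δ ≤
        ENNReal.ofReal (Real.exp (c * δ)) * weight H lam x)
    [IsFiniteMeasure (volume.withDensity (weight H lam))]
    (hw : IsPlanarBrownian w P) {X : Plane → ℝ≥0 → Ω → Plane}
    (hX : ∀ x, SolvesSDE H ε w P x (X x)) (t : ℝ≥0) :
    ∃ Y : Plane × Ω → Plane, Measurable Y ∧ (∀ x, ∀ᵐ ω ∂P, Y (x, ω) = X x t ω) ∧
      ((volume.withDensity (weight H lam)).prod P).map Y ≤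
        (Real.exp (c * t)).toNNReal • volume.withDensity (weight H lam) := by
  set μ : Measure Plane := volume.withDensity (weight H lam) with hμ
  have hfm := h.measurable_weight lam
  choose d hd hdw using fun n => hw.exists_isGaussianNoise (unifStep t n)
  set Z : ℕ → Plane × Ω → Plane := fun n p =>
    scheme (approxDrift H ε n) (unifStep t n) (fun i => d n i p.2) p.1 (n + 1) with hZ
  have hbm : ∀ n, Measurable (approxDrift H ε n) := fun n => (h.continuous_approxDrift ε n).measurable
  have hZm : ∀ n, Measurable (Z n) := fun n => (hd n).measurable_scheme_prod (hbm n) (n + 1)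
  -- Nothing is assumed about measurability of X in the starting point; the pointwise limit of the
  -- schemes supplies a jointly measurable version.
  set Y : Plane × Ω → Plane := fun p => limUnder atTop fun n => Z n p with hY
  have hYm : Measurable Y :=
    (StronglyMeasurable.limUnder fun n => (hZm n).stronglyMeasurable).measurable
  have hlim : ∀ x, ∀ᵐ ω ∂P, Tendsto (fun n => Z n (x, ω)) atTop (𝓝 (X x t ω)) := fun x =>
    (hX x).ae_tendsto_scheme h hε hw (fun n => partTime_unifStep t n)
      (a := t) (fun n k => by simp [unifStep]) hdw
  have hYX : ∀ x, ∀ᵐ ω ∂P, Y (x, ω) = X x t ω := fun x => by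
    filter_upwards [hlim x] with ω hω using hω.limUnder_eq
  refine ⟨Y, hYm, hYX, ?_⟩
  have hms : MeasurableSet {p | Tendsto (fun n => Z n p) atTop (𝓝 (Y p))} := by
    have : {p | Tendsto (fun n => Z n p) atTop (𝓝 (Y p))} =
        {p | ∃ l, Tendsto (fun n => Z n p) atTop (𝓝 l)} :=
      Set.ext fun p => ⟨fun hp => ⟨_, hp⟩, fun hp => tendsto_nhds_limUnder hp⟩
    rw [this]
    exact measurableSet_exists_tendsto hZm
  have hlim' : ∀ᵐ p ∂μ.prod P, Tendsto (fun n => Z n p) atTop (𝓝 (Y p)) := by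
    rw [Measure.ae_prod_iff_ae_ae hms]
    refine Eventually.of_forall fun x => ?_
    filter_upwards [hlim x, hYX x] with ω h1 h2
    rwa [h2]
  -- Exponent lost in one step: the drift error κ R r² with R = √(n+1) and r = t/(ε(n+1)), plus the
  -- Gaussian contribution.
  set e : ℕ → ℝ := fun n => κ * (√((n : ℝ) + 1) * (ε⁻¹ * (t / (n + 1 : ℕ))) ^ 2) +
    c * (t / (n + 1 : ℕ)) with he
  have hstep : ∀ᶠ n : ℕ in atTop, ∀ g : Plane → ℝ≥0∞, Measurable g →
      ∫⁻ p, g (Z n p) ∂μ.prod P ≤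
        ENNReal.ofReal (Real.exp (((n + 1 : ℕ) : ℝ) * e n)) * ∫⁻ x, g x ∂μ := by
    filter_upwards [(tendsto_div_succ t).eventually (ge_mem_nhds zero_lt_one),
      (tendsto_div_succ (ε⁻¹ * t)).eventually (ge_mem_nhds hr₀)] with n hn1 hn2 g hg
    have hk : ∀ k : ℕ, ∀ g : Plane → ℝ≥0∞, Measurable g →
        ∫⁻ x, weight H lam x * ∫⁻ y, g (x + (unifStep t n k : ℝ) • approxDrift H ε n x + y)
          ∂gaussPlane (unifStep t n k) ≤
        ENNReal.ofReal (Real.exp (e n)) * ∫⁻ x, weight H lam x * g x := fun k g hg => by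
      have hδ : ((unifStep t n k : ℝ≥0) : ℝ) = t / (n + 1 : ℕ) := by simp [unifStep]
      have hr : |ε⁻¹ * (t / (n + 1 : ℕ) : ℝ)| ≤ r₀ := by
        rw [abs_of_nonneg (by positivity), ← mul_div_assoc]; exact hn2
      have hGm : Measurable fun z => ∫⁻ y, g (z + y) ∂gaussPlane (unifStep t n k) :=
        Measurable.lintegral_prod_right' (f := fun q : Plane × Plane => g (q.1 + q.2))
          (by fun_prop)
      calc _ = ∫⁻ x, weight H lam x * (fun z => ∫⁻ y, g (z + y) ∂gaussPlane (unifStep t n k))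
            (x + (ε⁻¹ * (t / (n + 1 : ℕ)) : ℝ) • truncField H √(n + 1) x) := by
            simp only [approxDrift, hδ, smul_smul, mul_comm ε⁻¹]
        _ ≤ ENNReal.ofReal (Real.exp (κ * √(n + 1) * (ε⁻¹ * (t / (n + 1 : ℕ))) ^ 2)) *
            ∫⁻ x, weight H lam x * ∫⁻ y, g (x + y) ∂gaussPlane (unifStep t n k) :=
            hdrift _ (one_le_radius n) _ hr _
        _ = ENNReal.ofReal (Real.exp (κ * √(n + 1) * (ε⁻¹ * (t / (n + 1 : ℕ))) ^ 2)) *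
            ∫⁻ x, g x * ∫⁻ y, weight H lam (x - y) ∂gaussPlane (unifStep t n k) := by
            rw [lintegral_mul_lintegral_add_gaussPlane _ hfm hg]
        _ ≤ ENNReal.ofReal (Real.exp (κ * √(n + 1) * (ε⁻¹ * (t / (n + 1 : ℕ))) ^ 2)) *
            ∫⁻ x, ENNReal.ofReal (Real.exp (c * (t / (n + 1 : ℕ)))) *
              (weight H lam x * g x) := by
            refine mul_le_mul' le_rfl (lintegral_mono fun x => ?_)
            rw [← hδ, mul_comm (g x), ← mul_assoc]
            exact mul_le_mul' (hgauss _ (by rw [← NNReal.coe_le_coe, hδ]; exact hn1) x) le_rfl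
        _ = _ := by
            rw [lintegral_const_mul' _ _ ENNReal.ofReal_ne_top, ← mul_assoc,
              ← ENNReal.ofReal_mul (Real.exp_pos _).le, ← Real.exp_add, he]
            simp only [mul_assoc]
    have hmain := (hd n).lintegral_mul_lintegral_scheme_le (hbm n) hk (n + 1) hg
    rw [Finset.prod_const, Finset.card_range, ← ENNReal.ofReal_pow (Real.exp_pos _).le,
      ← Real.exp_nat_mul] at hmain
    have hGm : Measurable fun x => ∫⁻ ω, g (Z n (x, ω)) ∂P :=
      (hg.comp (hZm n)).lintegral_prod_right'
    rw [lintegral_prod (fun p => g (Z n p)) (hg.comp (hZm n)).aemeasurable, hμ,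
      lintegral_withDensity_eq_lintegral_mul _ hfm hGm,
      lintegral_withDensity_eq_lintegral_mul _ hfm hg]
    exact hmain
  -- All dependence on ε sits in a term of order (n+1)^{-1/2} and vanishes here.
  have hlimc : Tendsto (fun n : ℕ => ((n + 1 : ℕ) : ℝ) * e n) atTop (𝓝 (c * t)) := by
    have h1 : (fun n : ℕ => ((n + 1 : ℕ) : ℝ) * e n) =
        fun n : ℕ => κ * (ε⁻¹ * t) ^ 2 * (√((n : ℝ) + 1))⁻¹ + c * t := by
      funext n
      have hs : (((n + 1 : ℕ) : ℝ)) = √((n : ℝ) + 1) ^ 2 := by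
        rw [Real.sq_sqrt (by positivity)]; push_cast; rfl
      have hp : 0 < √((n : ℝ) + 1) := by have := one_le_radius n; linarith
      simp only [he]
      rw [hs]
      field_simp
    rw [h1]
    simpa using (tendsto_radius.inv_tendsto_atTop.const_mul (κ * (ε⁻¹ * t) ^ 2)).add_const (c * t)
  refine map_le_of_tendsto (by simp [Real.exp_pos]) hZm hYm hlim'
    (c := fun n => ENNReal.ofReal (Real.exp (((n + 1 : ℕ) : ℝ) * e n))) ?_ hstep
  exact ENNReal.tendsto_ofReal ((Real.continuous_exp.tendsto _).comp hlimc)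

end Diffusion

/-! ### The semigroup property -/

section Semigroup

variable {H : Plane → ℝ} {M : ℝ} {P : Measure Ω} [IsProbabilityMeasure P] {ε : ℝ}
  {w : ℝ≥0 → Ω → Plane} {X : Plane → ℝ≥0 → Ω → Plane}

/-- The Markov property, tested on continuous functions with compact support. -/
theorem transition_add (h : IsTameHamiltonian H M) (hε : 0 < ε) (hw : IsPlanarBrownian w P)
    (hX : ∀ x, SolvesSDE H ε w P x (X x)) (s t : ℝ≥0) {u : Plane → ℝ} (hu : Continuous u)
    (hus : HasCompactSupport u) (x : Plane) :
    transition P X (s + t) u x = transition P X s (transition P X t u) x := by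
  obtain ⟨C, hC⟩ : ∃ C, ∀ z, ‖u z‖ ≤ C := hus.exists_bound_of_continuous hu
  obtain ⟨L, hL0, -, hL⟩ := h.exists_lipschitz_approxDrift hε
  have hbm : ∀ n, Measurable (approxDrift H ε n) := fun n => (h.continuous_approxDrift ε n).measurable
  choose d hd hdw using fun n => hw.exists_isGaussianNoise (blockStep s t n)
  choose d' hd' hdw' using fun n => hw.exists_isGaussianNoise (unifStep t n)
  set A : ℕ → Plane → Ω → Plane := fun n z ω =>
    scheme (approxDrift H ε n) (unifStep t n) (fun i => d' n i ω) z (n + 1) with hA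
  have hAm : ∀ n, Measurable fun p : Plane × Ω => A n p.1 p.2 := fun n =>
    (hd' n).measurable_scheme_prod (hbm n) (n + 1)
  have hAm' : ∀ n z, Measurable (A n z) := fun n z => (hd' n).measurable_scheme (hbm n) z (n + 1)
  set B : ℕ → Plane → ℝ := fun n z => ∫ ω, u (A n z ω) ∂P with hB
  have hBm : ∀ n, Measurable (B n) := fun n =>
    (hu.measurable.comp (hAm n)).stronglyMeasurable.integral_prod_right'.measurable
  have hBC : ∀ n z, ‖B n z‖ ≤ C := fun n z => by
    simpa using norm_integral_le_of_norm_le_const (μ := P) (Eventually.of_forall fun ω => hC (A n z ω))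
  have hBlim : ∀ z, Tendsto (fun n => B n z) atTop (𝓝 (transition P X t u z)) := fun z => by
    refine tendsto_integral_of_dominated_convergence (fun _ => C)
      (fun n => (hu.measurable.comp (hAm' n z)).aestronglyMeasurable) (integrable_const C)
      (fun n => Eventually.of_forall fun ω => hC _) ?_
    filter_upwards [(hX z).ae_tendsto_scheme h hε hw (fun n => partTime_unifStep t n)
      (a := t) (fun n k => by simp [unifStep]) hdw'] with ω hω
    exact (hu.tendsto _).comp hω
  -- Equicontinuity uniform in n is what allows B n to be evaluated at the moving point given by the
  -- n-th scheme at time s.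
  have hBunif : ∀ η > 0, ∃ ρ > 0, ∀ n y z, dist y z < ρ → dist (B n y) (B n z) ≤ η := by
    intro η hη
    obtain ⟨ρ, hρ0, hρ⟩ := Metric.uniformContinuous_iff.1
      (hus.uniformContinuous_of_continuous hu) η hη
    refine ⟨ρ / Real.exp (L * t), by positivity, fun n y z hyz => ?_⟩
    have hAyz : ∀ ω, dist (A n y ω) (A n z ω) < ρ := fun ω => by
      have := norm_scheme_sub_le (δ := unifStep t n) (hL n) (fun i => d' n i ω) y z (n + 1)
      rw [partTime_unifStep] at this
      rw [lt_div_iff₀ (Real.exp_pos _), mul_comm, dist_eq_norm] at hyz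
      rw [dist_eq_norm]
      exact this.trans_lt hyz
    have hi : ∀ z, Integrable (fun ω => u (A n z ω)) P := fun z =>
      Integrable.of_bound (hu.measurable.comp (hAm' n z)).aestronglyMeasurable C
        (Eventually.of_forall fun ω => hC _)
    rw [dist_eq_norm, hB]
    simp only
    rw [← integral_sub (hi y) (hi z)]
    have := norm_integral_le_of_norm_le_const (μ := P) (C := η)
      (f := fun ω => u (A n y ω) - u (A n z ω)) (Eventually.of_forall fun ω => by
        rw [← dist_eq_norm]; exact (hρ (hAyz ω)).le)
    simpa using this
  have hle : ∀ n k, ((blockStep s t n k : ℝ≥0) : ℝ) ≤ (s + t : ℝ≥0) / (n + 1 : ℕ) := fun n k => by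
    have := blockStep_le s t n k
    exact_mod_cast this
  have lim1 : Tendsto (fun n => ∫ ω, u (scheme (approxDrift H ε n) (blockStep s t n)
      (fun i => d n i ω) x (n + 1 + (n + 1))) ∂P) atTop (𝓝 (transition P X (s + t) u x)) := by
    refine tendsto_integral_of_dominated_convergence (fun _ => C)
      (fun n => (hu.measurable.comp ((hd n).measurable_scheme (hbm n) x _)).aestronglyMeasurable)
      (integrable_const C) (fun n => Eventually.of_forall fun ω => hC _) ?_
    filter_upwards [(hX x).ae_tendsto_scheme h hε hw (fun n => partTime_blockStep_add s t n)
      hle hdw] with ω hω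
    exact (hu.tendsto _).comp hω
  have lim2 : Tendsto (fun n => ∫ ω, B n (scheme (approxDrift H ε n) (blockStep s t n)
      (fun i => d n i ω) x (n + 1)) ∂P) atTop
      (𝓝 (transition P X s (transition P X t u) x)) := by
    refine tendsto_integral_of_dominated_convergence (fun _ => C)
      (fun n => ((hBm n).comp ((hd n).measurable_scheme (hbm n) x _)).aestronglyMeasurable)
      (integrable_const C) (fun n => Eventually.of_forall fun ω => hBC _ _) ?_
    filter_upwards [(hX x).ae_tendsto_scheme h hε hw (fun n => partTime_blockStep s t n)
      hle hdw] with ω hω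
    refine (hBlim (X x s ω)).congr_dist ?_
    rw [Metric.tendsto_atTop]
    intro η hη
    obtain ⟨ρ, hρ0, hρ⟩ := hBunif (η / 2) (by positivity)
    obtain ⟨n₀, hn₀⟩ := Metric.tendsto_atTop.1 hω ρ hρ0
    refine ⟨n₀, fun n hn => ?_⟩
    rw [Real.dist_0_eq_abs, abs_of_nonneg dist_nonneg, dist_comm]
    exact (hρ n _ _ (hn₀ n hn)).trans_lt (by linarith)
  refine tendsto_nhds_unique lim1 (lim2.congr fun n => ?_)
  have hsh : IsGaussianNoise (fun k => blockStep s t n (n + 1 + k)) (d' n) P := by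
    rw [blockStep_add]; exact hd' n
  rw [(hd n).integral_scheme_add (hbm n) x (n + 1) hsh (n + 1) hu.measurable hC, blockStep_add]

/-- The measurable versions yield the operators and their bounds. They agree with X almost surely
for each fixed x, so the averages coincide at every x. -/
theorem exists_isTransitionSemigroupOn (h : IsTameHamiltonian H M) (hε : 0 < ε)
    (hw : IsPlanarBrownian w P) (hX : ∀ x, SolvesSDE H ε w P x (X x)) {μ : Measure Plane}
    [IsFiniteMeasure μ] {c : ℝ}
    (hver : ∀ t : ℝ≥0, ∃ Y : Plane × Ω → Plane, Measurable Y ∧ (∀ x, ∀ᵐ ω ∂P, Y (x, ω) = X x t ω) ∧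
      (μ.prod P).map Y ≤ (Real.exp (c * t)).toNNReal • μ) :
    ∃ S : ℝ≥0 → Lp ℝ 2 μ →L[ℝ] Lp ℝ 2 μ, IsTransitionSemigroupOn μ P X S ∧
      ∀ t, ‖S t‖ ≤ √(Real.exp (c * t)) := by
  choose Y hYm hYX hYle using hver
  have hYu : ∀ (t : ℝ≥0) (u : Plane → ℝ) x,
      (fun ω => u (Y t (x, ω))) =ᵐ[P] fun ω => u (X x t ω) := fun t u x => by
    filter_upwards [hYX t x] with ω hω
    rw [hω]
  have htr : ∀ (t : ℝ≥0) (u : Plane → ℝ),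
      (fun x => ∫ ω, u (Y t (x, ω)) ∂P) = transition P X t u := fun t u =>
    funext fun x => integral_congr_ae (hYu t u x)
  choose S hSn hS using fun t => exists_average_operator (hYm t) (hYle t)
  have hS' : ∀ (t : ℝ≥0) (u : Plane → ℝ) (hu : MemLp u 2 μ),
      S t (hu.toLp u) =ᵐ[μ] transition P X t u := fun t u hu => by
    rw [← htr t u]; exact hS t u hu
  have hmem : ∀ (t : ℝ≥0) (u : Plane → ℝ), MemLp u 2 μ → MemLp (transition P X t u) 2 μ :=
    fun t u hu => by
      rw [← htr t u]; exact memLp_average (hYm t) (hYle t) hu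
  refine ⟨S, ⟨fun t u hu => ?_, hS', ?_, fun s t => ?_⟩, fun t => ?_⟩
  · filter_upwards [ae_integrable_of_map_le (hYm t) (hYle t) hu] with x hx
    exact hx.congr (hYu t u x)
  · ext1 u
    refine Lp.ext ?_
    have hu := Lp.memLp u
    have h1 := hS' 0 u hu
    rw [Lp.toLp_coeFn] at h1
    filter_upwards [h1] with x hx
    rw [hx, transition, ContinuousLinearMap.id_apply]
    have : (fun ω => u (X x 0 ω)) =ᵐ[P] fun _ => u x := by
      filter_upwards [(hX x).ae_eval_zero hw] with ω hω
      rw [hω]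
    rw [integral_congr_ae this]
    simp
  · ext1 f
    -- Both sides of the semigroup law are continuous operators, so it suffices to check it on
    -- compactly supported continuous functions.
    have hdense : DenseRange (fun u : {u : Plane → ℝ // Continuous u ∧ HasCompactSupport u ∧
        MemLp u 2 μ} => u.2.2.2.toLp u.1) := by
      rw [Metric.denseRange_iff]
      intro f r hr
      obtain ⟨g, hgs, hg, hgc, hgm⟩ := (Lp.memLp f).exists_hasCompactSupport_eLpNorm_sub_le
        (by norm_num) (ε := ENNReal.ofReal (r / 2)) (by simpa using hr)
      refine ⟨⟨g, hgc, hgs, hgm⟩, ?_⟩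
      have e : f = (Lp.memLp f).toLp f := (Lp.toLp_coeFn f _).symm
      rw [e, dist_eq_norm, ← MemLp.toLp_sub, Lp.norm_toLp]
      refine (ENNReal.toReal_mono ENNReal.ofReal_ne_top hg).trans_lt ?_
      rw [ENNReal.toReal_ofReal (by positivity)]
      linarith
    refine congrFun (hdense.equalizer (S (s + t)).continuous ((S s).comp (S t)).continuous
      (funext fun u => ?_)) f
    obtain ⟨u, huc, hus, hu⟩ := u
    have e1 : S t (hu.toLp u) = (hmem t u hu).toLp _ :=
      Lp.ext ((hS' t u hu).trans (MemLp.coeFn_toLp _).symm)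
    simp only [Function.comp_apply, ContinuousLinearMap.comp_apply]
    rw [e1]
    refine Lp.ext ?_
    filter_upwards [hS' (s + t) u hu, hS' s _ (hmem t u hu)] with x h1 h2
    rw [h1, h2, transition_add h hε hw hX s t huc hus]
  · refine (hSn t).trans (le_of_eq ?_)
    rw [Real.coe_toNNReal _ (Real.exp_pos _).le]

end Semigroup

/-! ### An upper bound of coarea type -/

section Coarea

open scoped MeasureTheory

/-- For the sup norm the two-dimensional Hausdorff measure is Lebesgue measure, and passing to the
Euclidean norm is Lipschitz. -/
theorem exists_hausdorffMeasure_two_le : ∃ K : ℝ≥0, ∀ A : Set Plane,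
    Measure.hausdorffMeasure 2 A ≤ K * volume A := by
  obtain ⟨k, hl⟩ : ∃ k, LipschitzWith k (WithLp.toLp 2 : (Fin 2 → ℝ) → Plane) :=
    ⟨_, PiLp.lipschitzWith_toLp 2 fun _ : Fin 2 => ℝ⟩
  refine ⟨k ^ (2 : ℝ), fun A => ?_⟩
  have himg : WithLp.toLp 2 '' (WithLp.ofLp '' A) = A := by
    rw [← image_comp]; simp
  have h1 := hl.hausdorffMeasure_image_le (d := 2) (by norm_num) (WithLp.ofLp '' A)
  rw [himg] at h1
  have h2 : (Measure.hausdorffMeasure 2 : Measure (Fin 2 → ℝ)) = volume := by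
    have := hausdorffMeasure_pi_real (ι := Fin 2)
    simpa using this
  have h3 : volume (WithLp.ofLp '' A : Set (Fin 2 → ℝ)) = volume A := by
    have hmp := EuclideanSpace.volume_preserving_symm_measurableEquiv_toLp (Fin 2)
    have := (hmp.symm _).measure_preimage_equiv A
    rw [← this]
    congr 1
    ext v
    constructor
    · rintro ⟨a, ha, rfl⟩; exact ha
    · intro hv; exact ⟨WithLp.toLp 2 v, hv, rfl⟩
  rw [h2, h3] at h1
  refine h1.trans (le_of_eq ?_)
  rw [ENNReal.coe_rpow_of_nonneg _ (by norm_num)]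

theorem exists_cover_tsum_ediam_le {A : Set Plane} (hA : Measure.hausdorffMeasure 2 A ≠ ∞)
    {r η : ℝ≥0∞} (hr : 0 < r) (hη : 0 < η) : ∃ t : ℕ → Set Plane, (∀ i, t i ⊆ A) ∧
      A ⊆ ⋃ i, t i ∧ (∀ i, Metric.ediam (t i) ≤ r) ∧
      ∑' i, Metric.ediam (t i) ^ 2 ≤ Measure.hausdorffMeasure 2 A + η := by
  have h1 := Measure.hausdorffMeasure_apply 2 A
  have h2 : (⨅ (t : ℕ → Set Plane) (_ : A ⊆ ⋃ n, t n) (_ : ∀ n, Metric.ediam (t n) ≤ r),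
      ∑' n, ⨆ _ : (t n).Nonempty, Metric.ediam (t n) ^ (2 : ℝ)) < Measure.hausdorffMeasure 2 A + η := by
    refine lt_of_le_of_lt ?_ (ENNReal.lt_add_right hA hη.ne')
    rw [h1]
    exact le_iSup₂_of_le r hr le_rfl
  simp only [iInf_lt_iff] at h2
  obtain ⟨t, ht1, ht2, ht3⟩ := h2
  refine ⟨fun i => t i ∩ A, fun i => inter_subset_right, fun x hx => ?_, fun i =>
    (Metric.ediam_mono inter_subset_left).trans (ht2 i), le_trans ?_ ht3.le⟩
  · obtain ⟨i, hi⟩ := mem_iUnion.1 (ht1 hx)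
    exact mem_iUnion.2 ⟨i, hi, hx⟩
  · refine ENNReal.tsum_le_tsum fun i => ?_
    rcases (t i).eq_empty_or_nonempty with he | hne
    · simp [he]
    · refine le_iSup_of_le hne ?_
      rw [ENNReal.rpow_two]
      exact pow_le_pow_left' (Metric.ediam_mono inter_subset_left) 2

/-- **Eilenberg's inequality** for a function that is Lipschitz at small scales. -/
theorem exists_measurable_hausdorffMeasure_level_le {A : Set Plane} {H : Plane → ℝ}
    (hA : Measure.hausdorffMeasure 2 A ≠ ∞) {K : ℝ≥0} {r₀ : ℝ≥0∞} (hr₀ : 0 < r₀)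
    (hK : ∀ x ∈ A, ∀ y ∈ A, edist x y ≤ r₀ → edist (H x) (H y) ≤ K * edist x y) :
    ∃ G : ℝ → ℝ≥0∞, Measurable G ∧
      (∀ z, Measure.hausdorffMeasure 1 (A ∩ H ⁻¹' {z}) ≤ G z) ∧
      ∫⁻ z, G z ≤ K * Measure.hausdorffMeasure 2 A := by
  set r : ℕ → ℝ≥0∞ := fun n => min r₀ (n : ℝ≥0∞)⁻¹ with hr
  have hr0 : ∀ n, 0 < r n := fun n => lt_min hr₀ (ENNReal.inv_pos.2 (ENNReal.natCast_ne_top n))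
  have hrlim : Tendsto r atTop (𝓝 0) :=
    tendsto_of_tendsto_of_tendsto_of_le_of_le tendsto_const_nhds
      ENNReal.tendsto_inv_nat_nhds_zero (fun _ => zero_le) fun n => min_le_right _ _
  choose t htA hAt htr hts using fun n => exists_cover_tsum_ediam_le hA (hr0 n)
    (η := r n) (hr0 n)
  -- The covering sets need not be measurable; closing their images makes g measurable without
  -- changing diameters. Each g integrates to at most diam · K diam.
  set g : ℕ → ℕ → ℝ → ℝ≥0∞ := fun n i =>
    (closure (H '' t n i)).indicator fun _ => Metric.ediam (t n i) with hg
  have hgm : ∀ n i, Measurable (g n i) := fun n i =>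
    measurable_const.indicator isClosed_closure.measurableSet
  have hdiam : ∀ n i, Metric.ediam (H '' t n i) ≤ K * Metric.ediam (t n i) := fun n i => by
    refine Metric.ediam_le ?_
    rintro _ ⟨x, hx, rfl⟩ _ ⟨y, hy, rfl⟩
    have hxy := Metric.edist_le_ediam_of_mem hx hy
    exact (hK x (htA n i hx) y (htA n i hy)
      (hxy.trans ((htr n i).trans (min_le_left _ _)))).trans (by gcongr)
  have hgint : ∀ n, ∫⁻ z, ∑' i, g n i z ≤ K * (Measure.hausdorffMeasure 2 A + r n) := fun n => by
    rw [lintegral_tsum fun i => (hgm n i).aemeasurable]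
    calc ∑' i, ∫⁻ z, g n i z ≤ ∑' i, K * Metric.ediam (t n i) ^ 2 := by
          refine ENNReal.tsum_le_tsum fun i => ?_
          rw [hg, lintegral_indicator_const isClosed_closure.measurableSet]
          calc _ ≤ Metric.ediam (t n i) * (K * Metric.ediam (t n i)) := by
                gcongr
                exact (Real.volume_le_diam _).trans ((Metric.ediam_closure _).trans_le (hdiam n i))
            _ = _ := by ring
      _ ≤ _ := by rw [ENNReal.tsum_mul_left]; gcongr; exact hts n
  -- At height z the sum counts the diameters of the sets that can meet the level set, hence bounds
  -- its length in the limit; Fatou bounds the integral.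
  refine ⟨fun z => liminf (fun n => ∑' i, g n i z) atTop,
    Measurable.liminf fun n => Measurable.tsum (hgm n), fun z => ?_, ?_⟩
  · have hsub : ∀ n i, Metric.ediam (t n i ∩ H ⁻¹' {z}) ≤ r n := fun n i =>
      (Metric.ediam_mono inter_subset_left).trans (htr n i)
    refine (Measure.hausdorffMeasure_le_liminf_tsum 1 (A ∩ H ⁻¹' {z}) r hrlim
      (fun n i => t n i ∩ H ⁻¹' {z}) (Eventually.of_forall hsub)
      (Eventually.of_forall fun n x hx => ?_)).trans ?_
    · obtain ⟨i, hi⟩ := mem_iUnion.1 (hAt n hx.1)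
      exact mem_iUnion.2 ⟨i, hi, hx.2⟩
    · refine liminf_le_liminf (Eventually.of_forall fun n => ENNReal.tsum_le_tsum fun i => ?_)
      rw [ENNReal.rpow_one]
      rcases (t n i ∩ H ⁻¹' {z}).eq_empty_or_nonempty with he | ⟨x, hx, hxz⟩
      · simp [he]
      · have : z ∈ closure (H '' t n i) := subset_closure ⟨x, hx, hxz⟩
        rw [hg]
        simp only [indicator_of_mem this]
        exact Metric.ediam_mono inter_subset_left
  · refine (lintegral_liminf_le fun n => Measurable.tsum (hgm n)).trans ?_
    refine (liminf_le_liminf (Eventually.of_forall hgint)).trans (le_of_eq ?_)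
    have : Tendsto (fun n => (K : ℝ≥0∞) * (Measure.hausdorffMeasure 2 A + r n)) atTop
        (𝓝 (K * (Measure.hausdorffMeasure 2 A + 0))) :=
      ENNReal.Tendsto.const_mul (tendsto_const_nhds.add hrlim) (Or.inr ENNReal.coe_ne_top)
    rw [this.liminf_eq, add_zero]

/-- The part of the plane where `|∇H|` has order `2 ^ k` and `H` has integer part `j`. -/
def dyadicPiece (H : Plane → ℝ) (p : ℤ × ℕ) : Set Plane :=
  {x | ‖fderiv ℝ H x‖ ∈ Ico ((2 : ℝ) ^ p.1) (2 ^ (p.1 + 1)) ∧ H x ∈ Ico (p.2 : ℝ) (p.2 + 1)}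

variable {H : Plane → ℝ} {M : ℝ}

theorem IsTameHamiltonian.measurableSet_dyadicPiece (h : IsTameHamiltonian H M) (p : ℤ × ℕ) :
    MeasurableSet (dyadicPiece H p) :=
  (h.contDiff_fderiv.continuous.norm.measurable measurableSet_Ico).inter
    (h.continuous.measurable measurableSet_Ico)

theorem pairwise_disjoint_dyadicPiece (H : Plane → ℝ) :
    Pairwise (Function.onFun Disjoint (dyadicPiece H)) := by
  rintro ⟨k, j⟩ ⟨k', j'⟩ hne
  refine Set.disjoint_left.2 fun x hx hx' => hne ?_
  obtain ⟨⟨h1, h2⟩, h3, h4⟩ := hx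
  obtain ⟨⟨h1', h2'⟩, h3', h4'⟩ := hx'
  simp only at *
  have e1 : k < k' + 1 := (zpow_lt_zpow_iff_right₀ (by norm_num : (1 : ℝ) < 2)).1 (h1.trans_lt h2')
  have e2 : k' < k + 1 := (zpow_lt_zpow_iff_right₀ (by norm_num : (1 : ℝ) < 2)).1 (h1'.trans_lt h2)
  have e3 : j < j' + 1 := by exact_mod_cast h3.trans_lt h4'
  have e4 : j' < j + 1 := by exact_mod_cast h3'.trans_lt h4
  rw [Prod.mk.injEq]
  omega

/-- Within distance 2^k/M the quadratic Taylor term is at most 2^k times the distance; together with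
the linear term this stays below 2^{k+2}. -/
theorem IsTameHamiltonian.edist_le_of_mem_dyadicPiece (h : IsTameHamiltonian H M) (p : ℤ × ℕ)
    {x y : Plane} (hx : x ∈ dyadicPiece H p) (hxy : edist x y ≤ ENNReal.ofReal (2 ^ p.1 / M)) :
    edist (H x) (H y) ≤ ((2 : ℝ≥0) ^ (p.1 + 2) : ℝ≥0) * edist x y := by
  have hM := h.pos
  have h2 : (0 : ℝ) < 2 ^ p.1 := by positivity
  rw [edist_dist, ENNReal.ofReal_le_ofReal_iff (by positivity), le_div_iff₀ hM, dist_comm,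
    dist_eq_norm] at hxy
  rw [edist_dist, edist_dist, ← ENNReal.ofReal_coe_nnreal, ← ENNReal.ofReal_mul (by positivity)]
  refine ENNReal.ofReal_le_ofReal ?_
  rw [dist_comm, dist_comm x, Real.dist_eq, dist_eq_norm]
  have h1 := h.abs_taylor_le x (y - x)
  rw [add_sub_cancel] at h1
  have h3 : |fderiv ℝ H x (y - x)| ≤ 2 ^ (p.1 + 1) * ‖y - x‖ :=
    ((fderiv ℝ H x).le_opNorm _).trans (by gcongr; exact hx.1.2.le)
  have h4 : M * ‖y - x‖ ^ 2 ≤ 2 ^ p.1 * ‖y - x‖ := by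
    rw [sq]; nlinarith [norm_nonneg (y - x)]
  have h5 : |H y - H x| ≤ M * ‖y - x‖ ^ 2 + 2 ^ (p.1 + 1) * ‖y - x‖ := by
    have := abs_add_le (H y - H x - fderiv ℝ H x (y - x)) (fderiv ℝ H x (y - x))
    rw [sub_add_cancel] at this
    linarith
  push_cast
  rw [zpow_add₀ two_ne_zero, zpow_one] at h5
  rw [zpow_add₀ two_ne_zero]
  norm_num
  nlinarith [norm_nonneg (y - x)]

theorem IsTameHamiltonian.exists_volume_dyadicPiece_le (h : IsTameHamiltonian H M) {lam : ℝ}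
    (hlam : 0 < lam) : ∃ C : ℝ≥0, ∀ p, ENNReal.ofReal (profile lam p.2) * volume (dyadicPiece H p) ≤
      C * ∫⁻ x in dyadicPiece H p, weight H lam x := by
  obtain ⟨K, hK, hp⟩ := exists_profile_le_exp_mul hlam
  refine ⟨(Real.exp K).toNNReal, fun p => ?_⟩
  rw [← setLIntegral_const, ← lintegral_const_mul' _ _ ENNReal.coe_ne_top]
  refine setLIntegral_mono' (h.measurableSet_dyadicPiece p) fun x hx => ?_
  change _ ≤ ENNReal.ofReal (Real.exp K) * ENNReal.ofReal (profile lam (H x))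
  rw [← ENNReal.ofReal_mul (Real.exp_pos _).le]
  refine ENNReal.ofReal_le_ofReal ((hp _ (H x) (Nat.cast_nonneg _) (h.nonneg x)).trans ?_)
  have : |(p.2 : ℝ) - H x| ≤ 1 := abs_le.2 ⟨by linarith [hx.2.2], by linarith [hx.2.1]⟩
  refine mul_le_mul_of_nonneg_right (Real.exp_le_exp.2 ?_) (profile_pos _ _).le
  nlinarith

/-- The weighted integral of `1 / |∇H|` over the level sets of `H` has an integrable majorant. -/
theorem IsTameHamiltonian.exists_measurable_level_integral_le (h : IsTameHamiltonian H M) {lam : ℝ}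
    (hlam : 0 < lam) (hfin : ∫⁻ x, weight H lam x < ∞) :
    ∃ Φ : ℝ → ℝ≥0∞, ∫⁻ z, Φ z < ∞ ∧ ∀ z, 0 ≤ z → ENNReal.ofReal (profile lam z) *
      ∫⁻ x in H ⁻¹' {z}, ENNReal.ofReal ‖gradient H x‖⁻¹ ∂(Measure.hausdorffMeasure 1) ≤ Φ z := by
  have hM := h.pos
  obtain ⟨K₂, hK₂⟩ := exists_hausdorffMeasure_two_le
  obtain ⟨C, hC⟩ := h.exists_volume_dyadicPiece_le hlam
  -- The weight is bounded below on each piece and has finite total integral.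
  have hvol : ∀ p, volume (dyadicPiece H p) ≠ ∞ := fun p hp => by
    have h1 := hC p
    rw [hp, ENNReal.mul_top (by simpa using profile_pos _ _), top_le_iff] at h1
    exact ENNReal.mul_ne_top ENNReal.coe_ne_top
      ((setLIntegral_le_lintegral _ _).trans_lt hfin).ne h1
  choose G hGm hG1 hG2 using fun p => exists_measurable_hausdorffMeasure_level_le (H := H)
    (A := dyadicPiece H p) (ne_top_of_le_ne_top (ENNReal.mul_ne_top ENNReal.coe_ne_top (hvol p))
      (hK₂ _)) (K := (2 : ℝ≥0) ^ (p.1 + 2)) (r₀ := ENNReal.ofReal (2 ^ p.1 / M))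
    (ENNReal.ofReal_pos.2 (by positivity))
    (fun x hx y _ hxy => h.edist_le_of_mem_dyadicPiece p hx hxy)
  -- This bounds 1/|∇H| on the k-th piece; multiplied by the Lipschitz constant 2^{k+2} it gives 4
  -- for every k, so the sum over pieces converges.
  set a : ℤ → ℝ≥0 := fun k => 2 ^ (-k) with ha
  refine ⟨fun z => ∑' p : ℤ × ℕ, ENNReal.ofReal (profile lam p.2) * (a p.1 * G p z), ?_,
    fun z hz => ?_⟩
  · rw [lintegral_tsum fun p => (((hGm p).const_mul _).const_mul _).aemeasurable]
    calc ∑' p : ℤ × ℕ, ∫⁻ z, ENNReal.ofReal (profile lam p.2) * (a p.1 * G p z)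
        ≤ ∑' p : ℤ × ℕ, 4 * K₂ * (C * ∫⁻ x in dyadicPiece H p, weight H lam x) := by
          refine ENNReal.tsum_le_tsum fun p => ?_
          rw [lintegral_const_mul _ ((hGm p).const_mul _), lintegral_const_mul _ (hGm p)]
          have e : (a p.1 : ℝ≥0∞) * ((2 : ℝ≥0) ^ (p.1 + 2) : ℝ≥0) = 4 := by
            rw [← ENNReal.coe_mul, ha, ← zpow_add₀ two_ne_zero]
            norm_num
          calc _ ≤ ENNReal.ofReal (profile lam p.2) * (a p.1 * (((2 : ℝ≥0) ^ (p.1 + 2) : ℝ≥0) *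
                (K₂ * volume (dyadicPiece H p)))) := by
                gcongr
                exact (hG2 p).trans (by gcongr; exact hK₂ _)
            _ = (a p.1 * ((2 : ℝ≥0) ^ (p.1 + 2) : ℝ≥0)) * K₂ *
                (ENNReal.ofReal (profile lam p.2) * volume (dyadicPiece H p)) := by ring
            _ ≤ _ := by rw [e]; exact mul_le_mul' le_rfl (hC p)
      _ = 4 * K₂ * (C * ∫⁻ x in ⋃ p, dyadicPiece H p, weight H lam x) := by
          rw [ENNReal.tsum_mul_left, ENNReal.tsum_mul_left,
            lintegral_iUnion h.measurableSet_dyadicPiece (pairwise_disjoint_dyadicPiece H)]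
      _ < ∞ := by
          refine ENNReal.mul_lt_top (ENNReal.mul_lt_top (by simp) ENNReal.coe_lt_top)
            (ENNReal.mul_lt_top ENNReal.coe_lt_top ?_)
          exact (setLIntegral_le_lintegral _ _).trans_lt hfin
  · set j := ⌊z⌋₊ with hj
    have hjz : z ∈ Ico (j : ℝ) (j + 1) := ⟨Nat.floor_le hz, Nat.lt_floor_add_one z⟩
    have hprof : ENNReal.ofReal (profile lam z) ≤ ENNReal.ofReal (profile lam j) :=
      ENNReal.ofReal_le_ofReal (antitone_profile hlam hjz.1)
    have hint : ∫⁻ x in H ⁻¹' {z}, ENNReal.ofReal ‖gradient H x‖⁻¹ ∂(Measure.hausdorffMeasure 1) ≤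
        ∑' k : ℤ, a k * G (k, j) z := by
      calc _ ≤ ∫⁻ x in H ⁻¹' {z}, ∑' k : ℤ, (dyadicPiece H (k, j)).indicator (fun _ => (a k : ℝ≥0∞)) x
            ∂(Measure.hausdorffMeasure 1) := by
            refine setLIntegral_mono' (h.continuous.measurable (measurableSet_singleton z))
              fun x hx => ?_
            rw [norm_gradient]
            -- At a critical point the inverse of the zero norm is 0 by convention, so points
            -- outside every dyadic piece contribute nothing.
            rcases (norm_nonneg (fderiv ℝ H x)).eq_or_lt with h0 | h0
            · simp [← h0]
            · obtain ⟨k, hk⟩ := exists_mem_Ico_zpow h0 (by norm_num : (1 : ℝ) < 2)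
              have hxk : x ∈ dyadicPiece H (k, j) := ⟨hk, by rw [mem_preimage, mem_singleton_iff] at hx; rwa [hx]⟩
              refine le_trans ?_ (ENNReal.le_tsum k)
              rw [indicator_of_mem hxk, ← ENNReal.ofReal_coe_nnreal]
              refine ENNReal.ofReal_le_ofReal ?_
              rw [ha]
              push_cast
              rw [zpow_neg]
              exact inv_anti₀ (by positivity) hk.1
        _ = ∑' k : ℤ, a k * Measure.hausdorffMeasure 1 (dyadicPiece H (k, j) ∩ H ⁻¹' {z}) := by
            rw [lintegral_tsum fun k => (measurable_const.indicator
              (h.measurableSet_dyadicPiece _)).aemeasurable]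
            refine tsum_congr fun k => ?_
            rw [lintegral_indicator_const (h.measurableSet_dyadicPiece _),
              Measure.restrict_apply (h.measurableSet_dyadicPiece _)]
        _ ≤ _ := ENNReal.tsum_le_tsum fun k => by gcongr; exact hG1 _ z
    calc _ ≤ ENNReal.ofReal (profile lam j) * ∑' k : ℤ, a k * G (k, j) z :=
          mul_le_mul' hprof hint
      _ = ∑' k : ℤ, ENNReal.ofReal (profile lam j) * (a k * G (k, j) z) :=
          ENNReal.tsum_mul_left.symm
      _ ≤ _ := ENNReal.tsum_comp_le_tsum_of_injective
          (f := fun k : ℤ => ((k, j) : ℤ × ℕ)) (fun k k' hk => by simpa using hk)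
          fun p : ℤ × ℕ => ENNReal.ofReal (profile lam p.2) * (a p.1 * G p z)

end Coarea

/-! ### The weighted mass of the graph -/

namespace LevelGraph

variable {H : Plane → ℝ}

theorem continuous_height (hc : Continuous H) : Continuous (height H) :=
  Continuous.quotient_lift hc _

theorem proj_preimage_proj (H : Plane → ℝ) (x : Plane) :
    proj H ⁻¹' {proj H x} = levelComponent H x := by
  ext y
  rw [mem_preimage, mem_singleton_iff]
  constructor
  · intro h
    have e : levelComponent H y = levelComponent H x := Quotient.exact h
    exact e ▸ mem_levelComponent H y
  · intro h
    refine Quotient.sound (s := Setoid.ker (levelComponent H)) ?_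
    change levelComponent H y = levelComponent H x
    have hy : H y = H x := connectedComponentIn_subset {a | H a = H x} x h
    have e := connectedComponentIn_eq h
    rw [levelComponent, levelComponent, hy, e]

theorem proj_preimage_subset (p : LevelGraph H) : proj H ⁻¹' {p} ⊆ H ⁻¹' {height H p} := by
  intro x hx
  rw [mem_preimage, mem_singleton_iff] at hx ⊢
  rw [← hx]
  rfl

theorem isClosed_proj_preimage (hc : Continuous H) (p : LevelGraph H) :
    IsClosed (proj H ⁻¹' {p}) := by
  obtain ⟨x, rfl⟩ := Quotient.exists_rep p
  change IsClosed (proj H ⁻¹' {proj H x})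
  rw [proj_preimage_proj]
  have hcl : IsClosed {a | H a = H x} := isClosed_eq hc continuous_const
  refine isClosed_of_closure_subset ?_
  exact isPreconnected_connectedComponentIn.closure.subset_connectedComponentIn
    (subset_closure (mem_levelComponent H x))
    (closure_minimal (connectedComponentIn_subset _ _) hcl)

theorem measurableSet_height_image (hc : Continuous H) {I : Set (LevelGraph H)}
    (hI : I ∈ edges H) : MeasurableSet (height H '' I) := by
  obtain ⟨p, -, rfl⟩ := hI
  exact (isPreconnected_connectedComponentIn.image _
    (continuous_height hc).continuousOn).ordConnected.measurableSet

theorem eq_of_mem_edges {I J : Set (LevelGraph H)} (hI : I ∈ edges H) (hJ : J ∈ edges H)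
    {q : LevelGraph H} (hqI : q ∈ I) (hqJ : q ∈ J) : I = J := by
  obtain ⟨p, -, rfl⟩ := hI
  obtain ⟨p', -, rfl⟩ := hJ
  rw [connectedComponentIn_eq hqI, connectedComponentIn_eq hqJ]

theorem edgePoint_mem {I : Set (LevelGraph H)} {z : ℝ} (hz : z ∈ height H '' I) :
    edgePoint I z ∈ I := by
  have : Nonempty (LevelGraph H) := ⟨proj H 0⟩
  exact Function.invFunOn_mem hz

theorem height_edgePoint {I : Set (LevelGraph H)} {z : ℝ} (hz : z ∈ height H '' I) :
    height H (edgePoint I z) = z := by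
  have : Nonempty (LevelGraph H) := ⟨proj H 0⟩
  exact Function.invFunOn_eq hz

/-- The periods at one height of finitely many edges add up to at most the integral over the whole
level set. -/
theorem sum_period_edgePoint_le (hc : Continuous H) {T : Finset (edges H)} {z : ℝ}
    (hz : ∀ I ∈ T, z ∈ height H '' I.1) :
    ∑ I ∈ T, period (edgePoint I.1 z) ≤
      ∫⁻ x in H ⁻¹' {z}, ENNReal.ofReal ‖gradient H x‖⁻¹ ∂(Measure.hausdorffMeasure 1) := by
  unfold period
  rw [← lintegral_biUnion_finset (s := T) (t := fun I => proj H ⁻¹' {edgePoint I.1 z})]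
  · refine lintegral_mono_set (iUnion₂_subset fun I hI => ?_)
    refine (proj_preimage_subset _).trans ?_
    rw [height_edgePoint (hz I hI)]
  · intro I hI J hJ hIJ
    refine Disjoint.preimage _ (disjoint_singleton.2 fun he => hIJ (Subtype.ext ?_))
    exact eq_of_mem_edges I.2 J.2 (edgePoint_mem (hz I hI)) (he ▸ edgePoint_mem (hz J hJ))
  · exact fun I _ => (isClosed_proj_preimage hc _).measurableSet

end LevelGraph

/-- Superadditivity of the lower integral requires no measurability, which is not available for the
period as a function of height. -/
theorem sum_lintegral_le_lintegral_sum {α ι : Type*} [MeasurableSpace α] (μ : Measure α)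
    (T : Finset ι) (f : ι → α → ℝ≥0∞) :
    ∑ i ∈ T, ∫⁻ a, f i a ∂μ ≤ ∫⁻ a, ∑ i ∈ T, f i a ∂μ := by
  classical
  induction T using Finset.induction_on with
  | empty => simp
  | insert i T hi ih =>
    simp only [Finset.sum_insert hi]
    exact (add_le_add le_rfl ih).trans (le_lintegral_add _ _)

/-- Components at the same height on different edges are disjoint parts of one level set, so the
periods sum to at most the integral over that level set. -/
theorem IsTameHamiltonian.totalMass_lt_top {H : Plane → ℝ} {M lam : ℝ}
    (h : IsTameHamiltonian H M) (hlam : 0 < lam) (hfin : ∫⁻ x, weight H lam x < ∞) :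
    LevelGraph.totalMass (fun p => profile lam (LevelGraph.height H p)) < ∞ := by
  classical
  obtain ⟨Φ, hΦ, hle⟩ := h.exists_measurable_level_integral_le hlam hfin
  refine lt_of_le_of_lt ?_ hΦ
  unfold LevelGraph.totalMass
  -- Finite subsums suffice, so the number of edges plays no role.
  rw [ENNReal.tsum_eq_iSup_sum]
  refine iSup_le fun T => ?_
  set f : LevelGraph.edges H → ℝ → ℝ≥0∞ := fun I => (LevelGraph.height H '' I.1).indicator fun z =>
    ENNReal.ofReal (profile lam (LevelGraph.height H (LevelGraph.edgePoint I.1 z))) *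
      LevelGraph.period (LevelGraph.edgePoint I.1 z) with hf
  calc _ = ∑ I ∈ T, ∫⁻ z, f I z := Finset.sum_congr rfl fun I _ =>
        (lintegral_indicator (LevelGraph.measurableSet_height_image h.continuous I.2) _).symm
    _ ≤ ∫⁻ z, ∑ I ∈ T, f I z := sum_lintegral_le_lintegral_sum _ _ _
    _ ≤ ∫⁻ z, Φ z := lintegral_mono fun z => ?_
  have hsum : ∑ I ∈ T, f I z = ENNReal.ofReal (profile lam z) *
      ∑ I ∈ T with z ∈ LevelGraph.height H '' I.1,
        LevelGraph.period (LevelGraph.edgePoint I.1 z) := by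
    rw [Finset.mul_sum, Finset.sum_filter]
    refine Finset.sum_congr rfl fun I _ => ?_
    by_cases hz : z ∈ LevelGraph.height H '' I.1
    · simp only [hf]
      rw [if_pos hz, indicator_of_mem hz, LevelGraph.height_edgePoint hz]
    · simp only [hf]
      rw [if_neg hz, indicator_of_notMem hz]
  change ∑ I ∈ T, f I z ≤ Φ z
  rw [hsum]
  rcases (T.filter fun I => z ∈ LevelGraph.height H '' I.1).eq_empty_or_nonempty with he | ⟨I, hI⟩
  · rw [he]; simp
  · have hz0 : 0 ≤ z := by
      obtain ⟨q, -, rfl⟩ := (Finset.mem_filter.1 hI).2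
      induction q using Quotient.inductionOn with
      | h x => exact h.nonneg x
    exact (mul_le_mul' le_rfl (LevelGraph.sum_period_edgePoint_le h.continuous
      fun I hI => (Finset.mem_filter.1 hI).2)).trans (hle z hz0)

end

theorem mainTheorem5 (H : Plane → ℝ) (hH : IsGenericHamiltonian H) (lam : ℝ) (hlam : 0 < lam) :
    ∃ (h : ℝ → ℝ) (γ : LevelGraph H → ℝ),
      (ContDiffOn ℝ 2 h (Set.Ici 0) ∧ AntitoneOn h (Set.Ici 0) ∧ (∀ z, 0 ≤ z → 0 < h z) ∧
        ∃ C > (0 : ℝ), ∃ z₀ > (0 : ℝ), ∀ z, z₀ ≤ z → h z = C * Real.exp (-lam * √z)) ∧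
      Continuous γ ∧
      (∀ p, 0 < γ p) ∧
      (∀ x, γ (LevelGraph.proj H x) = h (H x)) ∧
      LevelGraph.totalMass γ < ∞ ∧
      ∃ c > (0 : ℝ), ∀ ε > (0 : ℝ),
        ∀ (Ω : Type*) [MeasurableSpace Ω] (P : Measure Ω) [IsProbabilityMeasure P]
          (w : ℝ≥0 → Ω → Plane) (X : Plane → ℝ≥0 → Ω → Plane),
          IsPlanarBrownian w P → (∀ x, SolvesSDE H ε w P x (X x)) →
            ∃ S : ℝ≥0 → Lp ℝ 2 (LevelGraph.weightedMeasure γ) →L[ℝ]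
                Lp ℝ 2 (LevelGraph.weightedMeasure γ),
              IsTransitionSemigroupOn (LevelGraph.weightedMeasure γ) P X S ∧
              ∀ t, ‖S t‖ ≤ Real.exp (c * t) := by
  obtain ⟨M, h⟩ := hH.exists_isTame
  obtain ⟨a₁, ha₁, a₂, ha₂, a₃, ha₃, R, hgr⟩ := hH.growth
  have hfin : ∫⁻ x, weight H lam x < ∞ :=
    lintegral_weight_lt_top hlam ha₁ fun x hx => (hgr x hx).1
  have : IsFiniteMeasure (volume.withDensity (weight H lam)) :=
    isFiniteMeasure_withDensity hfin.ne
  obtain ⟨c, hc, hgauss⟩ := h.exists_lintegral_weight_gaussPlane_le hlam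
  obtain ⟨κ, hκ, r₀, hr₀, hdrift⟩ := h.exists_lintegral_weight_drift_le hlam
  refine ⟨profile lam, fun p => profile lam (LevelGraph.height H p),
    ⟨(contDiff_profile lam (n := 2)).contDiffOn, (antitone_profile hlam).antitoneOn _,
      fun z _ => profile_pos lam z, 1, one_pos, 2, two_pos, fun z hz => ?_⟩,
    (contDiff_profile lam (n := 2)).continuous.comp (LevelGraph.continuous_height h.continuous),
    fun p => profile_pos lam _, fun _ => rfl, h.totalMass_lt_top hlam hfin, c, hc,
    fun ε hε Ω _ P _ w X hw hX => ?_⟩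
  · rw [profile, smoothSqrt_eq hz, one_mul]
  · obtain ⟨S, hS, hnorm⟩ := exists_isTransitionSemigroupOn h hε hw hX
      (μ := volume.withDensity (weight H lam))
      fun t => exists_measurable_version h hr₀ hε hdrift hgauss hw hX t
    refine ⟨S, hS, fun t => (hnorm t).trans ?_⟩
    exact Real.sqrt_le_self_iff.2 (.inr (Real.one_le_exp (by positivity)))
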